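/- Let $d\ge 1$, $n_1,\dots,n_d\in\mathbb N$ and $r_0,\dots,r_d\in\mathbb N$ with $r_0=r_d=1$. Let $E=\prod_{k=1}^d\mathbb R^{r_{k-1}\times n_k\times r_k}$ and let $\overline{\mathcal M}_r\subset E$ be the open set of all $\bar X=(X^1,\dots,X^d)$ such that for every $k$ the left unfolding $L(X^k)\in\mathbb R^{r_{k-1}n_k\times r_k}$ has rank $r_k$ and the right unfolding $R(X^k)\in\mathbb R^{r_{k-1}\times n_kr_k}$ has rank $r_{k-1}$; its tangent spaces are all $E$. For $\bar X\in E$ let $\phi(\bar X)\in\mathbb R^{n_1\times\cdots\times n_d}$ be the tensor $\phi(\bar X)(i_1,\dots,i_d)=X^1(i_1)X^2(i_2)\cdots X^d(i_d)$, where $X^k(i)\in\mathbb R^{r_{k-1}\times r_k}$ is the $i$-th slice of $X^k$. For $A=(A_1,\dots,A_{d-1})\in\mathcal G=GL(r_1)\times\cdots\times GL(r_{d-1})$ and $\bar Z\in E$ put $$\theta_A(\bar Z)=\{Z^1\times_3A_1^{\mathsf T},\;Z^2\times_1A_1^{-1}\times_3A_2^{\mathsf T},\;\dots,\;Z^d\times_1A_{d-1}^{-1}\}.$$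 Call $\bar X,\bar Y\in\overline{\mathcal M}_r$ equivalent if $\phi(\bar X)=\phi(\bar Y)$, let $[\bar X]$ be the equivalence class of $\bar X$, let $\overline{\mathcal M}_r/\mathcal G$ be the set of equivalence classes with the quotient topology, and $\pi(\bar X)=[\bar X]$. For $\bar X\in\overline{\mathcal M}_r$ and $\bar\xi,\bar\eta\in E$ the preconditioned metric is $$\bar g_{\bar X}(\bar\xi,\bar\eta)=\sum_{k=1}^d\big\langle\phi(X^1,\dots,X^{k-1},\xi^k,X^{k+1},\dots,X^d),\,\phi(X^1,\dots,X^{k-1},\eta^k,X^{k+1},\dots,X^d)\big\rangle .$$ The vertical space $\mathcal V_{\bar X}$ is the tangent space at $\bar X$ to $[\bar X]$ (the velocities at $\bar X$ of smooth curves in $[\bar X]$), and the horizontal space is $\mathcal H_{\bar X}=\{\bar\xi\in E:\bar g_{\bar X}(\bar\xi,\bar\eta)=0\text{ for all }\bar\eta\in\mathcal V_{\bar X}\}$. Then $\bar X,\bar Y\in\overline{\mathcal M}_r$ are equivalent if and only if $\bar Y=\theta_A(\bar X)$ for some $A\in\mathcal G$. The space $\overline{\mathcal M}_r/\mathcal G$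 is Hausdorff and second countable, and it has a smooth manifold structure of dimension $\sum_{k=1}^dr_{k-1}n_kr_k-\sum_{k=1}^{d-1}r_k^2$ for which $\pi$ is a smooth submersion (if $\overline{\mathcal M}_r=\emptyset$, this says nothing). For every such structure the following hold. (1) For every $\bar X\in\overline{\mathcal M}_r$ and every $\xi\in T_{[\bar X]}(\overline{\mathcal M}_r/\mathcal G)$ there is exactly one $\bar\xi_{\bar X}\in\mathcal H_{\bar X}$ with $\mathrm D\pi(\bar X)[\bar\xi_{\bar X}]=\xi$, the horizontal lift of $\xi$ at $\bar X$. (2) If $\bar Y=\theta_A(\bar X)$ with $\bar X,\bar Y\in\overline{\mathcal M}_r$ and $A\in\mathcal G$, then $\bar\xi_{\bar Y}=\theta_A(\bar\xi_{\bar X})$ for every $\xi\in T_{[\bar X]}(\overline{\mathcal M}_r/\mathcal G)$. (3) If $\bar X$ and $\bar Y$ are equivalent, then $\bar g_{\bar X}(\bar\xi_{\bar X},\bar\eta_{\bar X})=\bar g_{\bar Y}(\bar\xi_{\bar Y},\bar\eta_{\bar Y})$ for all $\xi,\eta\in T_{[\bar X]}(\overline{\mathcal M}_r/\mathcal G)$.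 (4) There is exactly one smooth Riemannian metric $g$ on $\overline{\mathcal M}_r/\mathcal G$ such that $g_{[\bar X]}(\xi,\eta)=\bar g_{\bar X}(\bar\xi_{\bar X},\bar\eta_{\bar X})$ for all $\bar X\in\overline{\mathcal M}_r$ and $\xi,\eta\in T_{[\bar X]}(\overline{\mathcal M}_r/\mathcal G)$. -/

import Mathlib

open scoped Manifold ContDiff

noncomputable section

namespace TensorTrain

/-- Third order tensors of size `a × m × b`. -/
abbrev Core (a m b : ℕ) : Type := Fin a → Fin m → Fin b → ℝ

/-- The left unfolding `L(Z)`, a matrix of size `(a m) × b`. -/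
def leftUnfold {a m b : ℕ} (Z : Core a m b) : Matrix (Fin a × Fin m) (Fin b) ℝ :=
  fun p l => Z p.1 p.2 l

/-- The right unfolding `R(Z)`, a matrix of size `a × (m b)`. -/
def rightUnfold {a m b : ℕ} (Z : Core a m b) : Matrix (Fin a) (Fin m × Fin b) ℝ :=
  fun l p => Z l p.1 p.2

/-- The mode-1 product `Z ×₁ A`. -/
def modeOne {a a' m b : ℕ} (Z : Core a m b) (A : Matrix (Fin a') (Fin a) ℝ) : Core a' m b :=
  fun j i l => ∑ s, Z s i l * A j s

/-- The mode-3 product `Z ×₃ A`. -/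
def modeThree {a m b b' : ℕ} (Z : Core a m b) (A : Matrix (Fin b') (Fin b) ℝ) : Core a m b' :=
  fun l i j => ∑ s, Z l i s * A j s

/-- The linear space of tuples of core tensors of sizes `r_{k-1} × n_k × r_k`, `k = 1, …, d`
(with `k` shifted so that it ranges over `Fin d`). -/
abbrev Cores {d : ℕ} (n : Fin d → ℕ) (r : Fin (d + 1) → ℕ) : Type :=
  ∀ k : Fin d, Core (r k.castSucc) (n k) (r k.succ)

/-- Full tensors of size `n_1 × ⋯ × n_d`. -/
abbrev Tensor {d : ℕ} (n : Fin d → ℕ) : Type := (∀ k : Fin d, Fin (n k)) → ℝ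

/-- The Euclidean (Frobenius) inner product of tensors. -/
def frobInner {d : ℕ} {n : Fin d → ℕ} (S T : Tensor n) : ℝ := ∑ i, S i * T i

/-- The map `φ` from tuples of cores to tensors,
`φ(X)(i_1, …, i_d) = ∑ X^1(ℓ_0, i_1, ℓ_1) X^2(ℓ_1, i_2, ℓ_2) ⋯ X^d(ℓ_{d-1}, i_d, ℓ_d)`;
when `r_0 = r_d = 1` the indices `ℓ_0` and `ℓ_d` take a single value. -/
def phi {d : ℕ} {n : Fin d → ℕ} {r : Fin (d + 1) → ℕ} (X : Cores n r) : Tensor n :=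
  fun i => ∑ l : (∀ k : Fin (d + 1), Fin (r k)), ∏ k : Fin d, X k (l k.castSucc) (i k) (l k.succ)

/-- The full rank conditions `rank L(X^k) = r_k`, `rank R(X^k) = r_{k-1}`, for all `k`. -/
def FullRank {d : ℕ} {n : Fin d → ℕ} {r : Fin (d + 1) → ℕ} (X : Cores n r) : Prop :=
  ∀ k : Fin d, (leftUnfold (X k)).rank = r k.succ ∧ (rightUnfold (X k)).rank = r k.castSucc

theorem rank_eq_iff_linearIndependent {m : Type} [Fintype m] {b : ℕ}
    (M : Matrix m (Fin b) ℝ) : M.rank = b ↔ LinearIndependent ℝ (fun j => M.col j) := by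
  rw [linearIndependent_iff_card_eq_finrank_span, Matrix.rank_eq_finrank_span_cols,
    Fintype.card_fin, Set.finrank]
  exact eq_comm

theorem isOpen_fullRank {d : ℕ} (n : Fin d → ℕ) (r : Fin (d + 1) → ℕ) :
    IsOpen {X : Cores n r | FullRank X} := by
  have h : {X : Cores n r | FullRank X} = ⋂ k : Fin d,
      ({X : Cores n r | LinearIndependent ℝ (fun j => (leftUnfold (X k)).col j)} ∩
        {X : Cores n r | LinearIndependent ℝ (fun j => (rightUnfold (X k)).transpose.col j)}) := by
    ext X
    simp only [FullRank, Set.mem_ofPred_eq, Set.mem_iInter, Set.mem_inter_iff,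
      ← rank_eq_iff_linearIndependent, Matrix.rank_transpose]
  rw [h]
  refine isOpen_iInter_of_finite fun k => IsOpen.inter ?_ ?_
  · refine isOpen_setOfPred_linearIndependent.preimage
      (f := fun X : Cores n r => fun j => (leftUnfold (X k)).col j) ?_
    unfold leftUnfold Matrix.col Matrix.transpose
    simp only
    fun_prop
  · refine isOpen_setOfPred_linearIndependent.preimage
      (f := fun X : Cores n r => fun j => (rightUnfold (X k)).transpose.col j) ?_
    unfold rightUnfold Matrix.col Matrix.transpose
    simp only [Matrix.of_apply]
    fun_prop

/-- The total space of tuples of full rank cores, an open subset of `Cores n r`, hence a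
smooth manifold all of whose tangent spaces are `Cores n r`. -/
def totalSpace {d : ℕ} (n : Fin d → ℕ) (r : Fin (d + 1) → ℕ) :
    TopologicalSpace.Opens (Cores n r) :=
  ⟨{X | FullRank X}, isOpen_fullRank n r⟩

/-- The group `GL(r_1) × ⋯ × GL(r_{d-1})`, as the group of tuples `(A_0, …, A_d)` of invertible
matrices with `A_0 = 1` and `A_d = 1`. -/
def gaugeGroup {d : ℕ} (r : Fin (d + 1) → ℕ) :
    Subgroup (∀ k : Fin (d + 1), GL (Fin (r k)) ℝ) where
  carrier := {A | A 0 = 1 ∧ A (Fin.last d) = 1}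
  one_mem' := by simp
  mul_mem' := by
    rintro A B ⟨h0, h1⟩ ⟨h2, h3⟩
    simp [h0, h1, h2, h3]
  inv_mem' := by
    rintro A ⟨h0, h1⟩
    simp [h0, h1]

/-- `θ_A(Z) = {Z^1 ×₃ A_1ᵀ, Z^2 ×₁ A_1⁻¹ ×₃ A_2ᵀ, …, Z^d ×₁ A_{d-1}⁻¹}`, on tuples of cores. -/
def theta {d : ℕ} {n : Fin d → ℕ} {r : Fin (d + 1) → ℕ} (A : gaugeGroup r) (Z : Cores n r) :
    Cores n r :=
  fun k => modeThree
    (modeOne (Z k) ((A.1 k.castSucc)⁻¹ : GL (Fin (r k.castSucc)) ℝ).1)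
    (A.1 k.succ).1.transpose

/-- Two points of the total space are equivalent if they represent the same tensor. -/
def equivSetoid {d : ℕ} (n : Fin d → ℕ) (r : Fin (d + 1) → ℕ) : Setoid (totalSpace n r) :=
  Setoid.ker fun X => phi X.1

/-- The quotient of the total space, the set of equivalence classes with the quotient topology. -/
def QuotientSpace {d : ℕ} (n : Fin d → ℕ) (r : Fin (d + 1) → ℕ) : Type :=
  Quotient (equivSetoid n r)

instance {d : ℕ} (n : Fin d → ℕ) (r : Fin (d + 1) → ℕ) : TopologicalSpace (QuotientSpace n r) :=
  inferInstanceAs (TopologicalSpace (Quotient (equivSetoid n r)))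

/-- The natural projection `π(X) = [X]`. -/
def proj {d : ℕ} {n : Fin d → ℕ} {r : Fin (d + 1) → ℕ} (X : totalSpace n r) :
    QuotientSpace n r :=
  Quotient.mk (equivSetoid n r) X

/-- The equivalence class `[X]`, as a subset of the linear space of tuples of cores. -/
def equivClass {d : ℕ} {n : Fin d → ℕ} {r : Fin (d + 1) → ℕ} (X : totalSpace n r) :
    Set (Cores n r) :=
  {Y | ∃ h : Y ∈ totalSpace n r, proj ⟨Y, h⟩ = proj X}

/-- The vertical space at `X`: the tangent space at `X` to the equivalence class `[X]`, that is,
the set of velocities at `X` of smooth curves in `[X]`. -/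
def verticalSpace {d : ℕ} {n : Fin d → ℕ} {r : Fin (d + 1) → ℕ} (X : totalSpace n r) :
    Set (Cores n r) :=
  {v | ∃ γ : ℝ → Cores n r, ContDiff ℝ ∞ γ ∧ (∀ t, γ t ∈ equivClass X) ∧ γ 0 = X.1 ∧
    deriv γ 0 = v}

/-- The preconditioned metric at `X`,
`∑ k, ⟨φ{X^1, …, ξ^k, …, X^d}, φ{X^1, …, η^k, …, X^d}⟩`. -/
def preMetric {d : ℕ} {n : Fin d → ℕ} {r : Fin (d + 1) → ℕ} (X : totalSpace n r)
    (ξ η : Cores n r) : ℝ :=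
  ∑ k : Fin d, frobInner (phi (Function.update X.1 k (ξ k))) (phi (Function.update X.1 k (η k)))

/-- The horizontal space at `X`: the orthogonal complement of the vertical space with respect to
the preconditioned metric. -/
def horizontalSpace {d : ℕ} {n : Fin d → ℕ} {r : Fin (d + 1) → ℕ} (X : totalSpace n r) :
    Set (Cores n r) :=
  {ξ | ∀ η ∈ verticalSpace X, preMetric X ξ η = 0}

/-- `∑_{k=1}^d r_{k-1} n_k r_k - ∑_{k=1}^{d-1} r_k^2`. (The subtraction of natural numbers
can only be truncated when the total space is empty.) -/
def quotientDim {d : ℕ} (n : Fin d → ℕ) (r : Fin (d + 1) → ℕ) : ℕ :=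
  (∑ k : Fin d, r k.castSucc * n k * r k.succ) -
    ∑ k ∈ Finset.univ.filter (fun k : Fin (d + 1) => k ≠ 0 ∧ k ≠ Fin.last d), r k ^ 2

/-- The Euclidean space on which the quotient is modelled. -/
abbrev QuotientModel {d : ℕ} (n : Fin d → ℕ) (r : Fin (d + 1) → ℕ) : Type :=
  EuclideanSpace ℝ (Fin (quotientDim n r))

/-- A manifold structure on the quotient makes it a quotient manifold of the total space if it is
smooth and the projection `π` is a smooth submersion. -/
structure IsQuotientManifold {d : ℕ} (n : Fin d → ℕ) (r : Fin (d + 1) → ℕ)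
    [ChartedSpace (QuotientModel n r) (QuotientSpace n r)] : Prop where
  isManifold : IsManifold 𝓘(ℝ, QuotientModel n r) ∞ (QuotientSpace n r)
  contMDiff_proj : ContMDiff 𝓘(ℝ, Cores n r) 𝓘(ℝ, QuotientModel n r) ∞
    (proj : totalSpace n r → QuotientSpace n r)
  surjective_mfderiv_proj : ∀ X : totalSpace n r, Function.Surjective
    (mfderiv 𝓘(ℝ, Cores n r) 𝓘(ℝ, QuotientModel n r)
      (proj : totalSpace n r → QuotientSpace n r) X)

/-- `ξbar` is a horizontal lift at `X` of the tangent vector `ξ` of the quotient at the point `q`: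
it is horizontal and `Dπ(X)[ξbar] = ξ`. The equation is one in the tangent bundle of the
quotient, so that it contains `π(X) = q`. -/
def IsHorizontalLift {d : ℕ} {n : Fin d → ℕ} {r : Fin (d + 1) → ℕ}
    [ChartedSpace (QuotientModel n r) (QuotientSpace n r)]
    (q : QuotientSpace n r) (ξ : TangentSpace 𝓘(ℝ, QuotientModel n r) q)
    (X : totalSpace n r) (ξbar : Cores n r) : Prop :=
  ξbar ∈ horizontalSpace X ∧
    tangentMap 𝓘(ℝ, Cores n r) 𝓘(ℝ, QuotientModel n r)
      (proj : totalSpace n r → QuotientSpace n r) ⟨X, ξbar⟩ = ⟨q, ξ⟩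

end TensorTrain

end

/-!
By the full rank conditions the left interface matrix of `X` at every cut has full column rank and
the right one full row rank. Two full rank tuples with the same tensor therefore have interface
matrices which differ by invertible factors, and these factors are a gauge transformation between
the two tuples: the fibres of `φ` are gauge orbits.

To build charts on the quotient, choose left inverses `Q_k` of the left unfoldings of `X`. The
affine space of all `Y` with `∑ i, Q_k(i) Y^k(i) = 1` in the middle positions has the dimension of
the quotient. It meets every orbit near that of `X` in exactly one normal form, which depends
smoothly on the orbit, so that it provides a slice of `π` through `X`.

The velocities of one-parameter subgroups of the gauge group are vertical, vertical vectors lie in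
`ker Dπ(X)`, and by the dimension of the quotient all three spaces agree. A vector is hence
horizontal if and only if it is orthogonal to `ker Dπ(X)`, and the metric `G` at `X` induces on the
tangent space of the quotient the form `(L G⁻¹ Lᵀ)⁻¹` with `L = Dπ(X)`. This form depends smoothly
on `X` and is the same at all points of an orbit, because gauge transformations are isometries.
-/

noncomputable section

/-! ### Quotients of inner products -/

section QuotientForm

variable {E F : Type*} [NormedAddCommGroup E] [NormedSpace ℝ E]
  [NormedAddCommGroup F] [NormedSpace ℝ F]

/-- Symmetric positive definite bilinear forms, the values of a Riemannian metric. -/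
structure PosDefForm (G : E →L[ℝ] E →L[ℝ] ℝ) : Prop where
  symm : ∀ v w, G v w = G w v
  pos : ∀ v, v ≠ 0 → 0 < G v v

/-- Horizontality with respect to a linear map `L`, the differential of a submersion:
`G`-orthogonality to the kernel of `L`. -/
def IsHorizontal (G : E →L[ℝ] E →L[ℝ] ℝ) (L : E →L[ℝ] F) (ξ : E) : Prop :=
  ∀ v, L v = 0 → G ξ v = 0

/-- The cometric `L G⁻¹ Lᵀ` that a surjection `L` induces from `G` on the dual of its target. -/
def quotCoform (G : E →L[ℝ] E →L[ℝ] ℝ) (L : E →L[ℝ] F) : (F →L[ℝ] ℝ) →L[ℝ] F :=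
  L ∘L G.inverse ∘L (ContinuousLinearMap.compL ℝ E F ℝ).flip L

/-- The form `(L G⁻¹ Lᵀ)⁻¹` that a surjection `L` induces from `G` on its target. It is
characterized by `quotForm_apply`; the closed formula makes its smooth dependence on `G` and `L`
evident. -/
def quotForm (G : E →L[ℝ] E →L[ℝ] ℝ) (L : E →L[ℝ] F) : F →L[ℝ] F →L[ℝ] ℝ :=
  (quotCoform G L).inverse

theorem quotCoform_apply (G : E →L[ℝ] E →L[ℝ] ℝ) (L : E →L[ℝ] F) (l : F →L[ℝ] ℝ) :
    quotCoform G L l = L (G.inverse (l ∘L L)) := rfl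

variable {G : E →L[ℝ] E →L[ℝ] ℝ} {L : E →L[ℝ] F}

theorem PosDefForm.eq_zero (hG : PosDefForm G) {v : E} (h : G v v = 0) : v = 0 := by
  by_contra hv
  exact (hG.pos v hv).ne' h

theorem IsHorizontal.eq_of_apply_eq (hG : PosDefForm G) {ξ η : E} (hξ : IsHorizontal G L ξ)
    (hη : IsHorizontal G L η) (h : L ξ = L η) : ξ = η := by
  have hker : L (ξ - η) = 0 := by rw [map_sub, h, sub_self]
  refine sub_eq_zero.1 (hG.eq_zero ?_)
  rw [map_sub G, sub_apply, hξ _ hker, hη _ hker, sub_zero]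

theorem IsHorizontal.exists_eq_comp [FiniteDimensional ℝ F] {ξ : E} (h : IsHorizontal G L ξ)
    (hL : Function.Surjective L) : ∃ l : F →L[ℝ] ℝ, G ξ = l ∘L L := by
  obtain ⟨R, hR⟩ := L.exists_rightInverse_of_surjective (LinearMap.range_eq_top.2 hL)
  refine ⟨G ξ ∘L R, ?_⟩
  ext v
  have hker : L (v - R (L v)) = 0 := by
    rw [map_sub, sub_eq_zero]
    exact (DFunLike.congr_fun hR (L v)).symm
  rw [← sub_eq_zero]
  simpa using h _ hker

section FiniteDimensional

variable [FiniteDimensional ℝ E]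

theorem isInvertible_of_forall_eq_zero_of_finrank_eq [FiniteDimensional ℝ F] {f : E →L[ℝ] F}
    (hf : ∀ v, f v = 0 → v = 0) (h : Module.finrank ℝ E = Module.finrank ℝ F) :
    f.IsInvertible :=
  ⟨(LinearEquiv.ofInjectiveOfFinrankEq f.toLinearMap
    (LinearMap.ker_eq_bot.1 (LinearMap.ker_eq_bot'.2 hf)) h).toContinuousLinearEquiv, rfl⟩

theorem finrank_dual_eq : Module.finrank ℝ (E →L[ℝ] ℝ) = Module.finrank ℝ E := by
  rw [← (LinearMap.toContinuousLinearMap (𝕜 := ℝ) (E := E) (F' := ℝ)).finrank_eq]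
  exact Subspace.dual_finrank_eq

theorem PosDefForm.isInvertible (hG : PosDefForm G) : G.IsInvertible :=
  isInvertible_of_forall_eq_zero_of_finrank_eq (fun v hv => hG.eq_zero (by rw [hv]; rfl))
    finrank_dual_eq.symm

theorem PosDefForm.isCoercive (hG : PosDefForm G) : IsCoercive G := by
  rcases subsingleton_or_nontrivial E with _ | _
  · exact ⟨1, one_pos, fun u => by simp [Subsingleton.elim u 0]⟩
  have : ProperSpace E := FiniteDimensional.proper ℝ E
  have hcont : Continuous fun v => G v v := G.continuous.clm_apply continuous_id
  obtain ⟨u, hu, hmin⟩ := (isCompact_sphere (0 : E) 1).exists_isMinOn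
    (NormedSpace.sphere_nonempty.2 zero_le_one) hcont.continuousOn
  have hu0 : u ≠ 0 := ne_zero_of_mem_unit_sphere ⟨u, hu⟩
  refine ⟨G u u, hG.pos u hu0, fun v => ?_⟩
  rcases eq_or_ne v 0 with rfl | hv
  · simp
  have hunit : G u u ≤ G (‖v‖⁻¹ • v) (‖v‖⁻¹ • v) :=
    hmin (mem_sphere_zero_iff_norm.2 (norm_smul_inv_norm hv))
  have hn : ‖v‖ ≠ 0 := norm_ne_zero_iff.2 hv
  calc G u u * ‖v‖ * ‖v‖ ≤ G (‖v‖⁻¹ • v) (‖v‖⁻¹ • v) * ‖v‖ * ‖v‖ := by gcongr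
    _ = G v v := by
      simp only [map_smul, smul_apply, smul_eq_mul]
      field_simp

theorem PosDefForm.isVonNBounded (hG : PosDefForm G) :
    Bornology.IsVonNBounded ℝ {v : E | G v v < 1} := by
  obtain ⟨c, hc, hcG⟩ := hG.isCoercive
  refine (NormedSpace.isVonNBounded_iff ℝ).2 <|
    isBounded_iff_forall_norm_le.2 ⟨√(1 / c), fun v hv => Real.le_sqrt_of_sq_le ?_⟩
  rw [le_div_iff₀ hc]
  calc ‖v‖ ^ 2 * c = c * ‖v‖ * ‖v‖ := by ring
    _ ≤ 1 := (hcG v).trans hv.le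

variable [FiniteDimensional ℝ F]

theorem PosDefForm.isInvertible_quotCoform (hG : PosDefForm G) (hL : Function.Surjective L) :
    (quotCoform G L).IsInvertible := by
  refine isInvertible_of_forall_eq_zero_of_finrank_eq (fun l hl => ?_) finrank_dual_eq
  rw [quotCoform_apply] at hl
  have hGinv : G (G.inverse (l ∘L L)) = l ∘L L := hG.isInvertible.self_apply_inverse _
  have hzero : G.inverse (l ∘L L) = 0 := hG.eq_zero <| by
    rw [hGinv, ContinuousLinearMap.comp_apply, hl, map_zero]
  rw [hzero, map_zero] at hGinv
  ext v
  obtain ⟨w, rfl⟩ := hL v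
  exact (DFunLike.congr_fun hGinv w).symm

theorem quotForm_apply (hG : PosDefForm G) (hL : Function.Surjective L) {ξ : E}
    (hξ : IsHorizontal G L ξ) (η : E) : quotForm G L (L ξ) (L η) = G ξ η := by
  obtain ⟨l, hl⟩ := hξ.exists_eq_comp hL
  have hLξ : quotCoform G L l = L ξ := by
    rw [quotCoform_apply, ← hl, hG.isInvertible.inverse_apply_self]
  rw [quotForm, ← hLξ, (hG.isInvertible_quotCoform hL).inverse_apply_self, hl]
  rfl

theorem exists_isHorizontal (hG : PosDefForm G) (hL : Function.Surjective L) (v : F) :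
    ∃ ξ, IsHorizontal G L ξ ∧ L ξ = v := by
  obtain ⟨l, hl⟩ := (hG.isInvertible_quotCoform hL).surjective v
  refine ⟨G.inverse (l ∘L L), fun w hw => ?_, hl⟩
  rw [hG.isInvertible.self_apply_inverse, ContinuousLinearMap.comp_apply, hw, map_zero]

theorem PosDefForm.quotForm (hG : PosDefForm G) (hL : Function.Surjective L) :
    PosDefForm (quotForm G L) where
  symm v w := by
    obtain ⟨ξ, hξ, rfl⟩ := exists_isHorizontal hG hL v
    obtain ⟨η, hη, rfl⟩ := exists_isHorizontal hG hL w
    rw [quotForm_apply hG hL hξ, quotForm_apply hG hL hη, hG.symm]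
  pos v hv := by
    obtain ⟨ξ, hξ, rfl⟩ := exists_isHorizontal hG hL v
    rw [quotForm_apply hG hL hξ]
    exact hG.pos ξ fun h => hv (by rw [h, map_zero])

theorem quotForm_map {E' F' : Type*} [NormedAddCommGroup E'] [NormedSpace ℝ E']
    [NormedAddCommGroup F'] [NormedSpace ℝ F'] [FiniteDimensional ℝ E'] [FiniteDimensional ℝ F']
    {G' : E' →L[ℝ] E' →L[ℝ] ℝ} {L' : E' →L[ℝ] F'} {T : E → E'} {C : F →L[ℝ] F'}
    (hG : PosDefForm G) (hL : Function.Surjective L)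
    (hG' : PosDefForm G') (hL' : Function.Surjective L')
    (hT : Function.Surjective T) (hC : Function.Injective C)
    (hTG : ∀ ξ η, G' (T ξ) (T η) = G ξ η) (hTL : ∀ ξ, L' (T ξ) = C (L ξ)) (v w : F) :
    quotForm G' L' (C v) (C w) = quotForm G L v w := by
  obtain ⟨ξ, hξ, rfl⟩ := exists_isHorizontal hG hL v
  obtain ⟨η, rfl⟩ := hL w
  have hTξ : IsHorizontal G' L' (T ξ) := fun u hu => by
    obtain ⟨u, rfl⟩ := hT u
    rw [hTG]
    exact hξ u (hC (by rw [← hTL, hu, map_zero]))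
  rw [← hTL, ← hTL, quotForm_apply hG' hL' hTξ, hTG, quotForm_apply hG hL hξ]

theorem contDiffAt_uncurry_quotForm (hG : PosDefForm G) (hL : Function.Surjective L) :
    ContDiffAt ℝ ∞ (fun p : (E →L[ℝ] E →L[ℝ] ℝ) × (E →L[ℝ] F) => quotForm p.1 p.2) (G, L) := by
  have : CompleteSpace E := FiniteDimensional.complete ℝ E
  have hinv : ContDiffAt ℝ ∞
      (fun p : (E →L[ℝ] E →L[ℝ] ℝ) × (E →L[ℝ] F) => p.1.inverse) (G, L) :=
    ContDiffAt.comp (g := ContinuousLinearMap.inverse) (G, L)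
      hG.isInvertible.contDiffAt_map_inverse contDiffAt_fst
  have htranspose : ContDiffAt ℝ ∞ (fun p : (E →L[ℝ] E →L[ℝ] ℝ) × (E →L[ℝ] F) =>
      (ContinuousLinearMap.compL ℝ E F ℝ).flip p.2) (G, L) :=
    (ContinuousLinearMap.contDiff _).contDiffAt.comp _ contDiffAt_snd
  have hcoform : ContDiffAt ℝ ∞
      (fun p : (E →L[ℝ] E →L[ℝ] ℝ) × (E →L[ℝ] F) => quotCoform p.1 p.2) (G, L) :=
    contDiffAt_snd.clm_comp (hinv.clm_comp htranspose)
  exact ContDiffAt.comp (g := ContinuousLinearMap.inverse) (G, L)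
    (hG.isInvertible_quotCoform hL).contDiffAt_map_inverse hcoform

end FiniteDimensional

end QuotientForm

/-! ### Charts from slices -/

section QuotientManifold

open Set Filter Topology

/-- A slice of `p : M → Q` near `X`: a smooth coordinate on a neighbourhood of `X` saturated under
`p`, which is constant on the fibres of `p`, together with a smooth inverse of it modulo `p` that
passes through `X`. -/
structure LocalSlice {E H M Q : Type*} [NormedAddCommGroup E] [NormedSpace ℝ E]
    [TopologicalSpace H] [TopologicalSpace M] [ChartedSpace H M] (I : ModelWithCorners ℝ E H)
    (F : Type*) [NormedAddCommGroup F] [NormedSpace ℝ F] (p : M → Q) (X : M) where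
  /-- The domain of the coordinate. -/
  dom : Set M
  /-- The coordinate. -/
  coord : M → F
  /-- The image of the coordinate. -/
  img : Set F
  /-- The inverse of the coordinate modulo `p`. -/
  sec : F → M
  isOpen_dom : IsOpen dom
  mem_dom : X ∈ dom
  mem_dom_of_eq {Y Z : M} : p Y = p Z → Y ∈ dom → Z ∈ dom
  contMDiffOn_coord : ContMDiffOn I 𝓘(ℝ, F) ∞ coord dom
  coord_congr {Y Z : M} : p Y = p Z → Y ∈ dom → coord Y = coord Z
  isOpen_img : IsOpen img
  contMDiffOn_sec : ContMDiffOn 𝓘(ℝ, F) I ∞ sec img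
  mapsTo_coord : MapsTo coord dom img
  mapsTo_sec : MapsTo sec img dom
  coord_sec {w : F} : w ∈ img → coord (sec w) = w
  apply_sec_coord {Y : M} : Y ∈ dom → p (sec (coord Y)) = p Y
  sec_coord : sec (coord X) = X

variable {E H F M Q : Type*} [NormedAddCommGroup E] [NormedSpace ℝ E]
  [NormedAddCommGroup F] [NormedSpace ℝ F] [TopologicalSpace H] [TopologicalSpace M]
  [ChartedSpace H M] {I : ModelWithCorners ℝ E H} {p : M → Q}

namespace LocalSlice

variable {X Y : M} (S : LocalSlice I F p X) (T : LocalSlice I F p Y)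

theorem preimage_image_dom : p ⁻¹' (p '' S.dom) = S.dom :=
  Subset.antisymm (fun _ ⟨_, hY, h⟩ => S.mem_dom_of_eq h hY) (subset_preimage_image p _)

variable [TopologicalSpace Q] (hp : IsQuotientMap p)
include hp

theorem isOpen_image_dom : IsOpen (p '' S.dom) := by
  rw [← hp.isOpen_preimage, S.preimage_image_dom]
  exact S.isOpen_dom

theorem coord_surjInv {Y : M} (hY : Y ∈ S.dom) :
    S.coord (Function.surjInv hp.surjective (p Y)) = S.coord Y :=
  (S.coord_congr (Function.surjInv_eq hp.surjective (p Y)).symm hY).symm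

/-- The chart of the base of a quotient map that a slice induces. -/
def chart : OpenPartialHomeomorph Q F where
  toFun q := S.coord (Function.surjInv hp.surjective q)
  invFun w := p (S.sec w)
  source := p '' S.dom
  target := S.img
  map_source' := by
    rintro _ ⟨Y, hY, rfl⟩
    exact S.coord_surjInv hp hY ▸ S.mapsTo_coord hY
  map_target' w hw := mem_image_of_mem p (S.mapsTo_sec hw)
  left_inv' := by
    rintro _ ⟨Y, hY, rfl⟩
    rw [S.coord_surjInv hp hY, S.apply_sec_coord hY]
  right_inv' w hw := by
    rw [S.coord_surjInv hp (S.mapsTo_sec hw), S.coord_sec hw]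
  open_source := S.isOpen_image_dom hp
  open_target := S.isOpen_img
  continuousOn_toFun := by
    rw [hp.continuousOn_isOpen_iff (S.isOpen_image_dom hp), S.preimage_image_dom]
    exact S.contMDiffOn_coord.continuousOn.congr fun Y hY => S.coord_surjInv hp hY
  continuousOn_invFun := hp.continuous.comp_continuousOn S.contMDiffOn_sec.continuousOn

theorem chart_apply {Y : M} (hY : Y ∈ S.dom) : S.chart hp (p Y) = S.coord Y :=
  S.coord_surjInv hp hY

theorem contDiffOn_chart_comp_chart_symm :
    ContDiffOn ℝ ∞ (T.chart hp ∘ (S.chart hp).symm)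
      ((S.chart hp).symm ≫ₕ T.chart hp).source := by
  have hsource : ((S.chart hp).symm ≫ₕ T.chart hp).source ⊆ S.img ∩ S.sec ⁻¹' T.dom :=
    fun _ hw => ⟨hw.1, T.preimage_image_dom.subset hw.2⟩
  refine (contMDiffOn_iff_contDiffOn.1 (T.contMDiffOn_coord.comp
    (S.contMDiffOn_sec.mono inter_subset_left) fun _ hw => hw.2)).congr_mono ?_ hsource
  exact fun w hw => T.chart_apply hp (hsource hw).2

variable [ChartedSpace F Q] (hS : S.chart hp ∈ atlas F Q)
include hS

theorem contMDiffAt_of_chart_mem_atlas [IsManifold 𝓘(ℝ, F) ∞ Q] :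
    ContMDiffAt I 𝓘(ℝ, F) ∞ p X := by
  have hdom : S.dom ∈ 𝓝 X := S.isOpen_dom.mem_nhds S.mem_dom
  have hsymm : ContMDiffAt 𝓘(ℝ, F) 𝓘(ℝ, F) ∞ (S.chart hp).symm (S.coord X) :=
    contMDiffAt_symm_of_mem_maximalAtlas (IsManifold.subset_maximalAtlas hS)
      (S.mapsTo_coord S.mem_dom)
  refine (hsymm.comp X (S.contMDiffOn_coord.contMDiffAt hdom)).congr_of_eventuallyEq ?_
  filter_upwards [hdom] with Y hY using (S.apply_sec_coord hY).symm

theorem surjective_mfderiv_of_chart_mem_atlas [IsManifold 𝓘(ℝ, F) ∞ Q] :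
    Function.Surjective (mfderiv I 𝓘(ℝ, F) p X) := by
  have hX : S.coord X ∈ S.img := S.mapsTo_coord S.mem_dom
  have hsurj : Function.Surjective (mfderiv 𝓘(ℝ, F) 𝓘(ℝ, F) (p ∘ S.sec) (S.coord X)) :=
    (mdifferentiable_of_mem_atlas (I := 𝓘(ℝ, F)) hS).symm.mfderiv_surjective hX
  have hp' : MDifferentiableAt I 𝓘(ℝ, F) p (S.sec (S.coord X)) := by
    rw [S.sec_coord]
    exact (S.contMDiffAt_of_chart_mem_atlas hp hS).mdifferentiableAt (by simp)
  have hsec : MDifferentiableAt 𝓘(ℝ, F) I S.sec (S.coord X) :=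
    (S.contMDiffOn_sec.contMDiffAt (S.isOpen_img.mem_nhds hX)).mdifferentiableAt (by simp)
  rw [mfderiv_comp _ hp' hsec, S.sec_coord] at hsurj
  exact Function.Surjective.of_comp hsurj

end LocalSlice

theorem exists_chartedSpace_of_localSlice [TopologicalSpace Q] (hp : IsQuotientMap p)
    (S : ∀ X, LocalSlice I F p X) :
    ∃ _ : ChartedSpace F Q, IsManifold 𝓘(ℝ, F) ∞ Q ∧ ContMDiff I 𝓘(ℝ, F) ∞ p ∧
      ∀ X, Function.Surjective (mfderiv I 𝓘(ℝ, F) p X) := by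
  let _ : ChartedSpace F Q :=
    { atlas := range fun X => (S X).chart hp
      chartAt := fun q => (S (Function.surjInv hp.surjective q)).chart hp
      mem_chart_source := fun q =>
        ⟨_, (S _).mem_dom, Function.surjInv_eq hp.surjective q⟩
      chart_mem_atlas := fun q => mem_range_self _ }
  have hmem (X : M) : (S X).chart hp ∈ atlas F Q := mem_range_self X
  have : IsManifold 𝓘(ℝ, F) ∞ Q := by
    refine isManifold_of_contDiffOn _ _ _ ?_
    rintro _ _ ⟨X, rfl⟩ ⟨Y, rfl⟩
    simpa using (S X).contDiffOn_chart_comp_chart_symm (S Y) hp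
  exact ⟨_, this, fun X => (S X).contMDiffAt_of_chart_mem_atlas hp (hmem X),
    fun X => (S X).surjective_mfderiv_of_chart_mem_atlas hp (hmem X)⟩

end QuotientManifold

section LocalSection

open Filter Topology

variable {E F : Type*} [NormedAddCommGroup E] [NormedSpace ℝ E]
  [NormedAddCommGroup F] [NormedSpace ℝ F] [FiniteDimensional ℝ F]

theorem exists_contDiffAt_section {f : E → F} {x : E} (hf : ContDiffAt ℝ ∞ f x)
    (hsurj : Function.Surjective (fderiv ℝ f x)) :
    ∃ s : F → E, ContDiffAt ℝ ∞ s (f x) ∧ s (f x) = x ∧ ∀ᶠ w in 𝓝 (f x), f (s w) = w := by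
  have : CompleteSpace F := FiniteDimensional.complete ℝ F
  have hn : (∞ : WithTop ℕ∞) ≠ 0 := by simp
  obtain ⟨R, hR⟩ := (fderiv ℝ f x).exists_rightInverse_of_surjective
    (LinearMap.range_eq_top.2 hsurj)
  have hzero : x + R 0 = x := by rw [map_zero, add_zero]
  have haff : ContDiff ℝ ∞ fun w => x + R w := by fun_prop
  have hcont : ContDiffAt ℝ ∞ (fun w => f (x + R w)) 0 :=
    ContDiffAt.comp (g := f) (0 : F) (hzero.symm ▸ hf) haff.contDiffAt
  have hderiv : HasFDerivAt (fun w => f (x + R w))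
      ((ContinuousLinearEquiv.refl ℝ F : F ≃L[ℝ] F) : F →L[ℝ] F) 0 := by
    have h := HasFDerivAt.comp (g := f) (0 : F)
      (hzero.symm ▸ (hf.differentiableAt hn).hasFDerivAt) (R.hasFDerivAt.const_add x)
    rwa [hzero, hR] at h
  have hinv := hcont.to_localInverse hderiv hn
  have himage := hcont.localInverse_apply_image hderiv hn
  have hright := (hcont.hasStrictFDerivAt' hderiv hn).eventually_right_inverse
  rw [hzero] at hinv himage hright
  exact ⟨fun w => x + R (hcont.localInverse hderiv hn w), haff.contDiffAt.comp _ hinv,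
    by simp only [himage, hzero], hright⟩

theorem exists_contMDiffAt_section {M Q : Type*} [TopologicalSpace M] [ChartedSpace E M]
    [IsManifold 𝓘(ℝ, E) ∞ M] [TopologicalSpace Q] [ChartedSpace F Q] [IsManifold 𝓘(ℝ, F) ∞ Q]
    {p : M → Q} {X : M} (hp : ContMDiffAt 𝓘(ℝ, E) 𝓘(ℝ, F) ∞ p X)
    (hsurj : Function.Surjective (mfderiv 𝓘(ℝ, E) 𝓘(ℝ, F) p X)) :
    ∃ s : Q → M, ContMDiffAt 𝓘(ℝ, F) 𝓘(ℝ, E) ∞ s (p X) ∧ s (p X) = X ∧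
      ∀ᶠ q in 𝓝 (p X), p (s q) = q := by
  set φ := extChartAt 𝓘(ℝ, E) X
  set ψ := extChartAt 𝓘(ℝ, F) (p X)
  set f : E → F := ψ ∘ p ∘ φ.symm
  have hφX : φ.symm (φ X) = X := extChartAt_to_inv X
  have hfX : f (φ X) = ψ (p X) := by simp only [f, Function.comp_apply, hφX]
  have hf : ContDiffAt ℝ ∞ f (φ X) := contDiffWithinAt_univ.1 <| by
    simpa only [modelWithCornersSelf_coe, Set.range_id] using (contMDiffAt_iff.1 hp).2
  have hf' : Function.Surjective (fderiv ℝ f (φ X)) := by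
    rw [(hp.mdifferentiableAt (by simp)).mfderiv, modelWithCornersSelf_coe, Set.range_id,
      fderivWithin_univ] at hsurj
    exact hsurj
  obtain ⟨s, hs, hsX, hfs⟩ := exists_contDiffAt_section hf hf'
  rw [hfX] at hs hsX hfs
  have hφ : ContMDiffAt 𝓘(ℝ, E) 𝓘(ℝ, E) ∞ φ.symm (s (ψ (p X))) :=
    hsX.symm ▸ (contMDiffOn_extChartAt_symm X).contMDiffAt (extChartAt_target_mem_nhds X)
  have hsec : ContMDiffAt 𝓘(ℝ, F) 𝓘(ℝ, E) ∞ (φ.symm ∘ s ∘ ψ) (p X) :=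
    hφ.comp (p X) (hs.contMDiffAt.comp (p X) contMDiffAt_extChartAt)
  have hsecX : (φ.symm ∘ s ∘ ψ) (p X) = X := by simp only [Function.comp_apply, hsX, hφX]
  refine ⟨φ.symm ∘ s ∘ ψ, hsec, hsecX, ?_⟩
  have hψ : ContinuousAt ψ (p X) := continuousAt_extChartAt (p X)
  have hpsec : ContinuousAt (p ∘ φ.symm ∘ s ∘ ψ) (p X) :=
    ContinuousAt.comp (hsecX.symm ▸ hp.continuousAt) hsec.continuousAt
  have hsource : ψ.source ∈ 𝓝 (p X) := extChartAt_source_mem_nhds (p X)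
  filter_upwards [hsource, hpsec.preimage_mem_nhds (by simpa [hsX, hφX] using hsource),
    hψ.eventually hfs] with q hq hq' hfq
  exact ψ.injOn hq' hq hfq

end LocalSection

section ModelDeriv

variable (E F : Type*) [NormedAddCommGroup E] [NormedSpace ℝ E]
  [NormedAddCommGroup F] [NormedSpace ℝ F] {M Q : Type*} [TopologicalSpace M] [ChartedSpace E M]
  [TopologicalSpace Q] [ChartedSpace F Q]

/-- The manifold derivative as a linear map between the model spaces, so that derivatives at
different points can be compared. -/
def modelDeriv (p : M → Q) (X : M) : E →L[ℝ] F := mfderiv 𝓘(ℝ, E) 𝓘(ℝ, F) p X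

variable {E F}

theorem tangentMap_eq_mk_iff {p : M → Q} {X : M} {ξ : E} {q : Q} {v : TangentSpace 𝓘(ℝ, F) q} :
    tangentMap 𝓘(ℝ, E) 𝓘(ℝ, F) p ⟨X, ξ⟩ = ⟨q, v⟩ ↔
      p X = q ∧ modelDeriv E F p X ξ = (v : F) := by
  constructor
  · intro h
    exact ⟨congrArg (fun x : TangentBundle 𝓘(ℝ, F) Q => x.1) h,
      congrArg (fun x : TangentBundle 𝓘(ℝ, F) Q => (x.2 : F)) h⟩
  · rintro ⟨rfl, h⟩
    exact congrArg (fun w : TangentSpace 𝓘(ℝ, F) (p X) => (⟨p X, w⟩ : TangentBundle 𝓘(ℝ, F) Q)) h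

theorem modelDeriv_extChartAt_comp [IsManifold 𝓘(ℝ, F) ∞ Q] {p : M → Q} {X : M}
    (hp : MDifferentiableAt 𝓘(ℝ, E) 𝓘(ℝ, F) p X) {q₀ : Q} (hX : p X ∈ (chartAt F q₀).source) :
    modelDeriv E F (fun Y => extChartAt 𝓘(ℝ, F) q₀ (p Y)) X =
      modelDeriv F F (extChartAt 𝓘(ℝ, F) q₀) (p X) ∘L modelDeriv E F p X :=
  mfderiv_comp X (mdifferentiableAt_extChartAt hX) hp

theorem bijective_modelDeriv_extChartAt [IsManifold 𝓘(ℝ, F) ∞ Q] {q₀ q : Q}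
    (hq : q ∈ (chartAt F q₀).source) :
    Function.Bijective (modelDeriv F F (extChartAt 𝓘(ℝ, F) q₀) q) :=
  (isInvertible_mfderiv_extChartAt (I := 𝓘(ℝ, F)) (x := q₀) (y := q) (by simpa using hq)).bijective

theorem contMDiffAt_modelDeriv {U : TopologicalSpace.Opens E} {f : U → F} {X : U}
    (hf : ContMDiffAt 𝓘(ℝ, E) 𝓘(ℝ, F) ∞ f X) :
    ContMDiffAt 𝓘(ℝ, E) 𝓘(ℝ, E →L[ℝ] F) ∞ (modelDeriv E F f) X := by
  set φ := extChartAt 𝓘(ℝ, E) X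
  have hchart : ContDiffAt ℝ ∞ (f ∘ φ.symm) X.1 := by
    have h := (contMDiffAt_iff_source.1 hf).contDiffWithinAt
    rwa [modelWithCornersSelf_coe, Set.range_id, contDiffWithinAt_univ] at h
  have hval : ContMDiffAt 𝓘(ℝ, E) 𝓘(ℝ, E →L[ℝ] F) ∞ (fun Y : U => fderiv ℝ (f ∘ φ.symm) Y) X :=
    contMDiffAt_subtype_iff.2 (hchart.fderiv_right le_rfl).contMDiffAt
  refine hval.congr_of_eventuallyEq ?_
  filter_upwards [(contMDiffAt_iff_contMDiffAt_nhds (by simp)).1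
    (hf.of_le (mod_cast le_top : (1 : WithTop ℕ∞) ≤ ∞))] with Y hY
  -- All charts of an open subset of `E` are the same.
  have hfderiv : modelDeriv E F f Y = fderivWithin ℝ (f ∘ φ.symm) (Set.range id) Y.1 :=
    (hY.mdifferentiableAt one_ne_zero).mfderiv
  rw [hfderiv, Set.range_id, fderivWithin_univ]

end ModelDeriv

/-! ### Riemannian submersions -/

section QuotientMetric

open Filter Topology

variable {F Q : Type*} [NormedAddCommGroup F] [NormedSpace ℝ F]
  [TopologicalSpace Q] [ChartedSpace F Q] [IsManifold 𝓘(ℝ, F) ∞ Q]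

theorem contMDiffAt_tangent_form
    {b : ∀ q : Q, TangentSpace 𝓘(ℝ, F) q →L[ℝ] TangentSpace 𝓘(ℝ, F) q →L[ℝ] ℝ} {q₀ : Q}
    {f : Q → F →L[ℝ] F →L[ℝ] ℝ} (hf : ContMDiffAt 𝓘(ℝ, F) 𝓘(ℝ, F →L[ℝ] F →L[ℝ] ℝ) ∞ f q₀)
    (h : ∀ᶠ q in 𝓝 q₀, ∀ v w : TangentSpace 𝓘(ℝ, F) q,
      f q (modelDeriv F F (extChartAt 𝓘(ℝ, F) q₀) q v)
        (modelDeriv F F (extChartAt 𝓘(ℝ, F) q₀) q w) = b q v w) :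
    ContMDiffAt 𝓘(ℝ, F) (𝓘(ℝ, F).prod 𝓘(ℝ, F →L[ℝ] F →L[ℝ] ℝ)) ∞
      (fun q ↦ Bundle.TotalSpace.mk' (F →L[ℝ] F →L[ℝ] ℝ)
        (E := fun q : Q => TangentSpace 𝓘(ℝ, F) q →L[ℝ] TangentSpace 𝓘(ℝ, F) q →L[ℝ] ℝ)
        q (b q)) q₀ := by
  rw [Bundle.contMDiffAt_section]
  refine hf.congr_of_eventuallyEq ?_
  filter_upwards [h, (chartAt F q₀).open_source.mem_nhds (mem_chart_source F q₀)] with q hq hq'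
  ext v w
  have hb : q ∈ (trivializationAt F (TangentSpace 𝓘(ℝ, F)) q₀).baseSet := hq'
  have hsymm (v : F) : modelDeriv F F (extChartAt 𝓘(ℝ, F) q₀) q
      ((trivializationAt F (TangentSpace 𝓘(ℝ, F)) q₀).symm q v) = v := by
    have hv := (trivializationAt F (TangentSpace 𝓘(ℝ, F)) q₀).continuousLinearMapAt_symmL
      (R := ℝ) hb v
    rwa [TangentBundle.continuousLinearMapAt_trivializationAt hq',
      Bundle.Trivialization.symmL_apply _ hb] at hv
  rw [hom_trivializationAt_apply, inCoordinates_apply_eq₂ hb hb (Set.mem_univ _), ← hq, hsymm,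
    hsymm]
  simp

variable {E : Type*} [NormedAddCommGroup E] [NormedSpace ℝ E] [FiniteDimensional ℝ E]
  [FiniteDimensional ℝ F] {U : TopologicalSpace.Opens E} {p : U → Q}
  {G : U → E →L[ℝ] E →L[ℝ] ℝ}

theorem contMDiffAt_quotForm_modelDeriv {f : U → F} {X : U}
    (hf : ContMDiffAt 𝓘(ℝ, E) 𝓘(ℝ, F) ∞ f X) (hf' : Function.Surjective (modelDeriv E F f X))
    (hG : PosDefForm (G X)) (hGc : ContMDiffAt 𝓘(ℝ, E) 𝓘(ℝ, E →L[ℝ] E →L[ℝ] ℝ) ∞ G X) :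
    ContMDiffAt 𝓘(ℝ, E) 𝓘(ℝ, F →L[ℝ] F →L[ℝ] ℝ) ∞
      (fun Y => quotForm (G Y) (modelDeriv E F f Y)) X :=
  ContMDiffAt.comp (g := fun p : (E →L[ℝ] E →L[ℝ] ℝ) × (E →L[ℝ] F) => quotForm p.1 p.2) X
    (contDiffAt_uncurry_quotForm hG hf').contMDiffAt
    (hGc.prodMk_space (contMDiffAt_modelDeriv hf))

theorem exists_riemannianMetric_eq_quotForm (hs : Function.Surjective p)
    (hp : ContMDiff 𝓘(ℝ, E) 𝓘(ℝ, F) ∞ p)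
    (hp' : ∀ X, Function.Surjective (modelDeriv E F p X)) (hG : ∀ X, PosDefForm (G X))
    (hGc : ContMDiff 𝓘(ℝ, E) 𝓘(ℝ, E →L[ℝ] E →L[ℝ] ℝ) ∞ G)
    (hGp : ∀ X Y, p X = p Y →
      quotForm (G X) (modelDeriv E F p X) = quotForm (G Y) (modelDeriv E F p Y)) :
    ∃ g : Bundle.ContMDiffRiemannianMetric 𝓘(ℝ, F) ∞ F
        (fun q : Q => TangentSpace 𝓘(ℝ, F) q),
      ∀ X, g.inner (p X) = quotForm (G X) (modelDeriv E F p X) := by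
  let b (q : Q) : F →L[ℝ] F →L[ℝ] ℝ :=
    quotForm (G (Function.surjInv hs q)) (modelDeriv E F p (Function.surjInv hs q))
  have hbp (X : U) : b (p X) = quotForm (G X) (modelDeriv E F p X) :=
    hGp _ _ (Function.surjInv_eq hs _)
  have hb (q : Q) : PosDefForm (b q) := (hG _).quotForm (hp' _)
  refine ⟨⟨b, fun q => (hb q).symm, fun q => (hb q).pos, fun q => (hb q).isVonNBounded, ?_⟩, hbp⟩
  intro q₀
  obtain ⟨X₀, rfl⟩ := hs q₀
  set ψ := extChartAt 𝓘(ℝ, F) (p X₀)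
  have hψp : ContMDiffAt 𝓘(ℝ, E) 𝓘(ℝ, F) ∞ (fun Y => ψ (p Y)) X₀ :=
    contMDiffAt_extChartAt.comp X₀ (hp X₀)
  have hchart (X : U) (hX : p X ∈ (chartAt F (p X₀)).source) :=
    modelDeriv_extChartAt_comp (hp.mdifferentiableAt (by simp) (x := X)) hX
  have hsurj (X : U) (hX : p X ∈ (chartAt F (p X₀)).source) :
      Function.Surjective (modelDeriv E F (fun Y => ψ (p Y)) X) := by
    rw [hchart X hX]
    exact (bijective_modelDeriv_extChartAt hX).surjective.comp (hp' X)
  obtain ⟨s, hsec, hsX₀, hps⟩ := exists_contMDiffAt_section (hp X₀) (hp' X₀)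
  refine contMDiffAt_tangent_form
    (f := fun q => quotForm (G (s q)) (modelDeriv E F (fun Y => ψ (p Y)) (s q))) ?_ ?_
  · refine ContMDiffAt.comp
      (g := fun X => quotForm (G X) (modelDeriv E F (fun Y => ψ (p Y)) X)) (p X₀) ?_ hsec
    rw [hsX₀]
    exact contMDiffAt_quotForm_modelDeriv hψp (hsurj X₀ (mem_chart_source F _)) (hG X₀) (hGc X₀)
  filter_upwards [hps, (chartAt F (p X₀)).open_source.mem_nhds (mem_chart_source F (p X₀))]
    with q hq hqs v w
  obtain ⟨X, hX, rfl⟩ : ∃ X, s q = X ∧ p X = q := ⟨_, rfl, hq⟩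
  rw [hX, hbp]
  exact quotForm_map (T := id) (hG X) (hp' X) (hG X) (hsurj X hqs) Function.surjective_id
    (bijective_modelDeriv_extChartAt hqs).injective (fun _ _ => rfl)
    (fun ξ => congrArg (· ξ) (hchart X hqs)) v w

end QuotientMetric

namespace TensorTrain

open Matrix

section Chain

variable {K : Type*} {d : ℕ} {ι : Fin (d + 1) → Type*} [∀ k, Fintype (ι k)]

/-- The product of the first `k` matrices of a chain, multiplied from the left by a row of ones. -/
def leftProd [Semiring K] (M : ∀ k : Fin d, Matrix (ι k.castSucc) (ι k.succ) K) :
    ∀ k : Fin (d + 1), ι k → K :=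
  Fin.induction (fun _ => 1) (fun k v => v ᵥ* M k)

/-- The product of the matrices of a chain from position `k` on, multiplied from the right by a
column of ones. -/
def rightProd [Semiring K] (M : ∀ k : Fin d, Matrix (ι k.castSucc) (ι k.succ) K) :
    ∀ k : Fin (d + 1), ι k → K :=
  Fin.reverseInduction (fun _ => 1) (fun k v => M k *ᵥ v)

section Semiring

variable [Semiring K] (M M' : ∀ k : Fin d, Matrix (ι k.castSucc) (ι k.succ) K)

theorem leftProd_succ (k : Fin d) : leftProd M k.succ = leftProd M k.castSucc ᵥ* M k := by
  simp [leftProd]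

theorem rightProd_last : rightProd M (Fin.last d) = fun _ => 1 := by
  simp [rightProd]

theorem rightProd_castSucc (k : Fin d) :
    rightProd M k.castSucc = M k *ᵥ rightProd M k.succ := by
  simp [rightProd]

theorem leftProd_congr {k : Fin (d + 1)} (h : ∀ j : Fin d, j.castSucc < k → M j = M' j) :
    leftProd M k = leftProd M' k := by
  induction k using Fin.induction with
  | zero => rfl
  | succ k ih =>
    rw [leftProd_succ, leftProd_succ, h k Fin.castSucc_lt_succ,
      ih fun j hj => h j (hj.trans Fin.castSucc_lt_succ)]

theorem rightProd_congr {k : Fin (d + 1)} (h : ∀ j : Fin d, k ≤ j.castSucc → M j = M' j) :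
    rightProd M k = rightProd M' k := by
  induction k using Fin.reverseInduction with
  | last => rw [rightProd_last, rightProd_last]
  | cast k ih =>
    rw [rightProd_castSucc, rightProd_castSucc, h k le_rfl,
      ih fun j hj => h j (Fin.castSucc_lt_succ.le.trans hj)]

theorem leftProd_dotProduct_rightProd (k : Fin (d + 1)) :
    leftProd M k ⬝ᵥ rightProd M k = ∑ l, rightProd M 0 l := by
  induction k using Fin.induction with
  | zero => simp [leftProd, dotProduct]
  | succ k ih => rw [← ih, leftProd_succ, rightProd_castSucc, dotProduct_mulVec]

end Semiring

theorem rightProd_tail [Semiring K] {ι : Fin (d + 2) → Type*} [∀ k, Fintype (ι k)]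
    (M : ∀ k : Fin (d + 1), Matrix (ι k.castSucc) (ι k.succ) K) (k : Fin (d + 1)) :
    rightProd (ι := fun j => ι j.succ) (fun j : Fin d => M j.succ) k = rightProd M k.succ := by
  induction k using Fin.reverseInduction with
  | last => exact (rightProd_last _).trans (rightProd_last M).symm
  | cast k ih =>
    rw [rightProd_castSucc, ih]
    exact (rightProd_castSucc M k.succ).symm

theorem sum_mul_prod_eq_sum_mul_rightProd [CommSemiring K]
    (M : ∀ k : Fin d, Matrix (ι k.castSucc) (ι k.succ) K) (f : ι 0 → K) :
    ∑ l : (∀ k : Fin (d + 1), ι k), f (l 0) * ∏ k : Fin d, M k (l k.castSucc) (l k.succ) =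
      ∑ l, f l * rightProd M 0 l := by
  induction d with
  | zero =>
    have hM : rightProd M 0 = fun _ => 1 := rightProd_last M
    simp only [Finset.univ_eq_empty, Finset.prod_empty, hM, mul_one]
    exact Fintype.sum_equiv (Equiv.piUnique fun k : Fin 1 => ι k) _ _ fun _ => rfl
  | succ d ih =>
    rw [← (Fin.consEquiv ι).sum_comp, Fintype.sum_prod_type]
    refine Finset.sum_congr rfl fun a _ => ?_
    have htail := ih (ι := fun j => ι j.succ) (fun j => M j.succ) (fun l => M 0 a l)
    simp only [Fin.consEquiv_apply, Fin.cons_zero, Fin.prod_univ_succ, ← Finset.mul_sum]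
      at htail ⊢
    congr 1
    rw [show rightProd M 0 = M 0 *ᵥ rightProd M (Fin.succ 0) from rightProd_castSucc M 0,
      ← rightProd_tail M 0]
    exact htail

end Chain

section Unfolding

variable {a m b : ℕ}

/-- The `i`-th slice `Z(i)` of a core `Z`. -/
def slice (Z : Core a m b) (i : Fin m) : Matrix (Fin a) (Fin b) ℝ :=
  fun l l' => Z l i l'

theorem core_ext_slice {Z Z' : Core a m b} (h : ∀ i, slice Z i = slice Z' i) : Z = Z' := by
  funext l i l'
  exact congrFun (congrFun (h i) l) l'

theorem mulVec_leftUnfold_eq_zero_iff (Z : Core a m b) (v : Fin b → ℝ) :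
    leftUnfold Z *ᵥ v = 0 ↔ ∀ i, slice Z i *ᵥ v = 0 := by
  simp only [funext_iff, Prod.forall]
  exact forall_comm

theorem vecMul_rightUnfold_eq_zero_iff (Z : Core a m b) (v : Fin a → ℝ) :
    v ᵥ* rightUnfold Z = 0 ↔ ∀ i, v ᵥ* slice Z i = 0 := by
  simp only [funext_iff, Prod.forall]
  rfl

theorem rank_eq_iff_mulVec_eq_zero {I : Type} [Finite I] (M : Matrix I (Fin b) ℝ) :
    M.rank = b ↔ ∀ v, M *ᵥ v = 0 → v = 0 := by
  have := Fintype.ofFinite I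
  rw [rank_eq_iff_linearIndependent, ← Matrix.mulVec_injective_iff, ← Matrix.coe_mulVecLin,
    ← LinearMap.ker_eq_bot, LinearMap.ker_eq_bot']

theorem rank_leftUnfold_iff (Z : Core a m b) :
    (leftUnfold Z).rank = b ↔ ∀ v : Fin b → ℝ, (∀ i, slice Z i *ᵥ v = 0) → v = 0 := by
  simp only [rank_eq_iff_mulVec_eq_zero, mulVec_leftUnfold_eq_zero_iff]

theorem rank_rightUnfold_iff (Z : Core a m b) :
    (rightUnfold Z).rank = a ↔ ∀ v : Fin a → ℝ, (∀ i, v ᵥ* slice Z i = 0) → v = 0 := by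
  simp only [← Matrix.rank_transpose (rightUnfold Z), rank_eq_iff_mulVec_eq_zero,
    mulVec_transpose, vecMul_rightUnfold_eq_zero_iff]

end Unfolding

/-! ### Interface matrices -/

section Interface

variable {d : ℕ} {n : Fin d → ℕ} {r : Fin (d + 1) → ℕ}

/-- The left interface `X^1(i_1) ⋯ X^k(i_k)`, a row vector when `r_0 = 1`. -/
def leftInterface (X : Cores n r) (k : Fin (d + 1)) (i : ∀ k : Fin d, Fin (n k)) :
    Fin (r k) → ℝ :=
  leftProd (ι := fun k => Fin (r k)) (fun j => slice (X j) (i j)) k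

/-- The right interface `X^{k+1}(i_{k+1}) ⋯ X^d(i_d)`, a column vector when `r_d = 1`. -/
def rightInterface (X : Cores n r) (k : Fin (d + 1)) (i : ∀ k : Fin d, Fin (n k)) :
    Fin (r k) → ℝ :=
  rightProd (ι := fun k => Fin (r k)) (fun j => slice (X j) (i j)) k

theorem leftInterface_zero (X : Cores n r) (i) : leftInterface X 0 i = fun _ => 1 := rfl

theorem leftInterface_succ (X : Cores n r) (k : Fin d) (i) :
    leftInterface X k.succ i = leftInterface X k.castSucc i ᵥ* slice (X k) (i k) :=
  leftProd_succ _ k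

theorem rightInterface_last (X : Cores n r) (i) :
    rightInterface X (Fin.last d) i = fun _ => 1 :=
  rightProd_last _

theorem rightInterface_castSucc (X : Cores n r) (k : Fin d) (i) :
    rightInterface X k.castSucc i = slice (X k) (i k) *ᵥ rightInterface X k.succ i :=
  rightProd_castSucc _ k

theorem leftInterface_congr {X X' : Cores n r} {k : Fin (d + 1)} {i i' : ∀ k : Fin d, Fin (n k)}
    (hX : ∀ j : Fin d, j.castSucc < k → X j = X' j)
    (hi : ∀ j : Fin d, j.castSucc < k → i j = i' j) :
    leftInterface X k i = leftInterface X' k i' :=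
  leftProd_congr _ _ fun j hj => by rw [hX j hj, hi j hj]

theorem rightInterface_congr {X X' : Cores n r} {k : Fin (d + 1)}
    {i i' : ∀ k : Fin d, Fin (n k)}
    (hX : ∀ j : Fin d, k ≤ j.castSucc → X j = X' j)
    (hi : ∀ j : Fin d, k ≤ j.castSucc → i j = i' j) :
    rightInterface X k i = rightInterface X' k i' :=
  rightProd_congr _ _ fun j hj => by rw [hX j hj, hi j hj]

theorem phi_eq_leftInterface_dotProduct_rightInterface (X : Cores n r) (k : Fin (d + 1)) (i) :
    phi X i = leftInterface X k i ⬝ᵥ rightInterface X k i := by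
  rw [leftInterface, rightInterface, leftProd_dotProduct_rightProd]
  simpa [phi, slice] using sum_mul_prod_eq_sum_mul_rightProd
    (ι := fun k => Fin (r k)) (fun j => slice (X j) (i j)) (fun _ => 1)

/-- The multi-index that agrees with `i` before position `k` and with `i'` from position `k` on. -/
def spliceIndex (k : Fin (d + 1)) (i i' : ∀ k : Fin d, Fin (n k)) : ∀ k : Fin d, Fin (n k) :=
  fun j => if j.castSucc < k then i j else i' j

theorem phi_spliceIndex (X : Cores n r) (k : Fin (d + 1)) (i i') :
    phi X (spliceIndex k i i') = leftInterface X k i ⬝ᵥ rightInterface X k i' := by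
  rw [phi_eq_leftInterface_dotProduct_rightInterface X k]
  congr 1
  · exact leftInterface_congr (fun _ _ => rfl) fun j hj => if_pos hj
  · exact rightInterface_congr (fun _ _ => rfl) fun j hj => if_neg (not_lt.2 hj)

theorem leftInterface_update_index (X : Cores n r) (k : Fin d) (i m) :
    leftInterface X k.castSucc (Function.update i k m) = leftInterface X k.castSucc i :=
  leftInterface_congr (fun _ _ => rfl)
    fun _ hj => Function.update_of_ne (Fin.castSucc_lt_castSucc_iff.1 hj).ne _ _

theorem rightInterface_update_index (X : Cores n r) (k : Fin d) (i m) :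
    rightInterface X k.succ (Function.update i k m) = rightInterface X k.succ i :=
  rightInterface_congr (fun _ _ => rfl)
    fun _ hj => Function.update_of_ne (Fin.succ_le_castSucc_iff.1 hj).ne' _ _

theorem leftInterface_update (X : Cores n r) (k : Fin d) (ζ i) :
    leftInterface (Function.update X k ζ) k.castSucc i = leftInterface X k.castSucc i :=
  leftInterface_congr
    (fun _ hj => Function.update_of_ne (Fin.castSucc_lt_castSucc_iff.1 hj).ne _ _) fun _ _ => rfl

theorem rightInterface_update (X : Cores n r) (k : Fin d) (ζ i) :
    rightInterface (Function.update X k ζ) k.succ i = rightInterface X k.succ i :=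
  rightInterface_congr
    (fun _ hj => Function.update_of_ne (Fin.succ_le_castSucc_iff.1 hj).ne' _ _) fun _ _ => rfl

theorem phi_update (X : Cores n r) (k : Fin d) (ζ i) :
    phi (Function.update X k ζ) i =
      leftInterface X k.castSucc i ⬝ᵥ (slice ζ (i k) *ᵥ rightInterface X k.succ i) := by
  rw [phi_eq_leftInterface_dotProduct_rightInterface _ k.castSucc, rightInterface_castSucc,
    leftInterface_update, rightInterface_update, Function.update_self]

namespace FullRank

variable {X : Cores n r}

theorem eq_zero_of_slice_mulVec (hX : FullRank X) (k : Fin d) {v : Fin (r k.succ) → ℝ}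
    (hv : ∀ i, slice (X k) i *ᵥ v = 0) : v = 0 :=
  (rank_leftUnfold_iff _).1 (hX k).1 v hv

theorem eq_zero_of_vecMul_slice (hX : FullRank X) (k : Fin d) {v : Fin (r k.castSucc) → ℝ}
    (hv : ∀ i, v ᵥ* slice (X k) i = 0) : v = 0 :=
  (rank_rightUnfold_iff _).1 (hX k).2 v hv

theorem rank_pos (hX : FullRank X) (h1 : 0 < r (Fin.last d)) (k : Fin (d + 1)) : 0 < r k := by
  induction k using Fin.reverseInduction with
  | last => exact h1
  | cast k ih =>
    by_contra h0
    have : IsEmpty (Fin (r k.castSucc)) := by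
      rw [Nat.eq_zero_of_not_pos h0]; infer_instance
    have hone : (1 : Fin (r k.succ) → ℝ) = 0 :=
      hX.eq_zero_of_slice_mulVec k fun i => funext isEmptyElim
    exact one_ne_zero (congrFun hone ⟨0, ih⟩)

theorem mode_pos (hX : FullRank X) (h1 : 0 < r (Fin.last d)) (k : Fin d) : 0 < n k := by
  by_contra h0
  have : IsEmpty (Fin (n k)) := by
    rw [Nat.eq_zero_of_not_pos h0]; infer_instance
  have hone : (1 : Fin (r k.succ) → ℝ) = 0 := hX.eq_zero_of_slice_mulVec k isEmptyElim
  exact one_ne_zero (congrFun hone ⟨0, hX.rank_pos h1 _⟩)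

theorem eq_zero_of_leftInterface_dotProduct (hX : FullRank X) (h0 : r 0 = 1)
    (h1 : 0 < r (Fin.last d)) {k : Fin (d + 1)} {v : Fin (r k) → ℝ}
    (hv : ∀ i, leftInterface X k i ⬝ᵥ v = 0) : v = 0 := by
  induction k using Fin.induction with
  | zero =>
    have : Subsingleton (Fin (r 0)) := by rw [h0]; infer_instance
    funext l
    simpa [leftInterface_zero, dotProduct, Fintype.sum_subsingleton _ l] using
      hv fun k => ⟨0, hX.mode_pos h1 k⟩
  | succ k ih =>
    refine hX.eq_zero_of_slice_mulVec k fun m => ih fun i => ?_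
    have hvm := hv (Function.update i k m)
    rwa [leftInterface_succ, ← dotProduct_mulVec, leftInterface_update_index,
      Function.update_self] at hvm

theorem eq_zero_of_dotProduct_rightInterface (hX : FullRank X)
    (h1 : r (Fin.last d) = 1) {k : Fin (d + 1)} {v : Fin (r k) → ℝ}
    (hv : ∀ i, v ⬝ᵥ rightInterface X k i = 0) : v = 0 := by
  induction k using Fin.reverseInduction with
  | last =>
    have : Subsingleton (Fin (r (Fin.last d))) := by rw [h1]; infer_instance
    funext l
    simpa [rightInterface_last, dotProduct, Fintype.sum_subsingleton _ l] using
      hv fun k => ⟨0, hX.mode_pos (h1 ▸ one_pos) k⟩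
  | cast k ih =>
    refine hX.eq_zero_of_vecMul_slice k fun m => ih fun i => ?_
    have hvm := hv (Function.update i k m)
    rwa [rightInterface_castSucc, dotProduct_mulVec, rightInterface_update_index,
      Function.update_self] at hvm

end FullRank

end Interface

end TensorTrain

theorem exists_mul_eq_one_of_mulVec_eq_zero {K I J : Type*} [Field K] [Fintype I] [Fintype J]
    [DecidableEq J] {M : Matrix I J K} (h : ∀ v, M.mulVec v = 0 → v = 0) :
    ∃ P : Matrix J I K, P * M = 1 := by
  classical
  obtain ⟨g, hg⟩ := M.mulVecLin.exists_leftInverse_of_injective (LinearMap.ker_eq_bot'.2 h)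
  refine ⟨LinearMap.toMatrix' g, ?_⟩
  rw [← LinearMap.toMatrix'_toLin' M, ← LinearMap.toMatrix'_comp, Matrix.toLin'_apply', hg,
    LinearMap.toMatrix'_id]

namespace TensorTrain

open Matrix

section Gauge

variable {d : ℕ} {n : Fin d → ℕ} {r : Fin (d + 1) → ℕ}

/-- The algebra of families of square matrices of sizes `r_0, …, r_d`, of which the gauge group
is a subgroup of the units. -/
abbrev GaugeAlg (r : Fin (d + 1) → ℕ) : Type := ∀ k : Fin (d + 1), Matrix (Fin (r k)) (Fin (r k)) ℝ

/-- The tuple of cores with slices `A'_{k-1} Z^k(i) A_k`. It extends `theta`, the case `A' = A⁻¹`,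
to arbitrary pairs of families, so that it is polynomial in `A'` and `A`. -/
def act (A' A : GaugeAlg r) (Z : Cores n r) : Cores n r :=
  fun k l i l' => (A' k.castSucc * slice (Z k) i * A k.succ) l l'

theorem slice_act (A' A : GaugeAlg r) (Z : Cores n r) (k : Fin d) (i : Fin (n k)) :
    slice (act A' A Z k) i = A' k.castSucc * slice (Z k) i * A k.succ := rfl

theorem cores_ext_slice {Z Z' : Cores n r} (h : ∀ k i, slice (Z k) i = slice (Z' k) i) : Z = Z' :=
  funext fun k => core_ext_slice (h k)

theorem slice_add {a m b : ℕ} (Z Z' : Core a m b) (i) :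
    slice (Z + Z') i = slice Z i + slice Z' i := rfl

theorem slice_smul {a m b : ℕ} (c : ℝ) (Z : Core a m b) (i) :
    slice (c • Z) i = c • slice Z i := rfl

theorem theta_eq_act (A : gaugeGroup r) (Z : Cores n r) :
    theta A Z = act (fun k => ((A.1 k)⁻¹ : GL (Fin (r k)) ℝ).1) (fun k => (A.1 k).1) Z := by
  funext k l i l'
  simp only [theta, act, modeThree, modeOne, Matrix.mul_apply, transpose_apply, slice, mul_comm]

theorem slice_theta (A : gaugeGroup r) (Z : Cores n r) (k : Fin d) (i : Fin (n k)) :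
    slice (theta A Z k) i = ((A.1 k.castSucc)⁻¹ : GL (Fin (r k.castSucc)) ℝ).1 * slice (Z k) i *
      (A.1 k.succ).1 := by
  rw [theta_eq_act, slice_act]

/-- The gauge transformation `θ_A` as a linear map. -/
def thetaLin (A : gaugeGroup r) : Cores n r →ₗ[ℝ] Cores n r where
  toFun := theta A
  map_add' Z Z' := cores_ext_slice fun k i => by
    simp only [slice_theta, Pi.add_apply, slice_add, Matrix.mul_add, Matrix.add_mul]
  map_smul' c Z := cores_ext_slice fun k i => by
    simp only [slice_theta, Pi.smul_apply, slice_smul, Matrix.mul_smul, Matrix.smul_mul,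
      RingHom.id_apply]

theorem theta_mul (A B : gaugeGroup r) (Z : Cores n r) :
    theta (A * B) Z = theta B (theta A Z) :=
  cores_ext_slice fun k i => by simp [slice_theta, Matrix.mul_assoc]

theorem theta_one (Z : Cores n r) : theta 1 Z = Z :=
  cores_ext_slice fun k i => by simp [slice_theta]

theorem theta_theta_inv (A : gaugeGroup r) (Z : Cores n r) : theta A (theta A⁻¹ Z) = Z := by
  rw [← theta_mul, inv_mul_cancel, theta_one]

/-- The gauge transformation given by a family of matrices and their inverses. -/
def gaugeMk (A A' : GaugeAlg r) (h : A * A' = 1) (h0 : A 0 = 1) (h1 : A (Fin.last d) = 1) :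
    gaugeGroup r :=
  ⟨fun k => ⟨A k, A' k, congrFun h k, mul_eq_one_comm.1 (congrFun h k)⟩,
    Units.ext h0, Units.ext h1⟩

theorem theta_gaugeMk (A A' : GaugeAlg r) (h : A * A' = 1) (h0 : A 0 = 1)
    (h1 : A (Fin.last d) = 1) (Z : Cores n r) : theta (gaugeMk A A' h h0 h1) Z = act A' A Z :=
  theta_eq_act _ _

theorem leftInterface_theta (A : gaugeGroup r) (Z : Cores n r) (k : Fin (d + 1)) (i) :
    leftInterface (theta A Z) k i = leftInterface Z k i ᵥ* (A.1 k).1 := by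
  induction k using Fin.induction with
  | zero => simp [leftInterface_zero, A.2.1]
  | succ k ih =>
    rw [leftInterface_succ, leftInterface_succ, ih, slice_theta, vecMul_vecMul, vecMul_vecMul,
      Matrix.mul_assoc, ← Matrix.mul_assoc (A.1 k.castSucc).1, Units.mul_inv, Matrix.one_mul]

theorem phi_theta (A : gaugeGroup r) (Z : Cores n r) : phi (theta A Z) = phi Z := by
  funext i
  simp only [phi_eq_leftInterface_dotProduct_rightInterface _ (Fin.last d), leftInterface_theta,
    A.2.2, rightInterface_last, Units.val_one, vecMul_one]

theorem FullRank.theta (A : gaugeGroup r) {X : Cores n r} (hX : FullRank X) :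
    FullRank (theta A X) := by
  refine fun k => ⟨(rank_leftUnfold_iff _).2 fun v hv => ?_,
    (rank_rightUnfold_iff _).2 fun v hv => ?_⟩
  · have h : (A.1 k.succ).1 *ᵥ v = 0 := hX.eq_zero_of_slice_mulVec k fun i => by
      simpa [slice_theta, ← Matrix.mul_assoc] using congrArg ((A.1 k.castSucc).1 *ᵥ ·) (hv i)
    simpa using congrArg (((A.1 k.succ)⁻¹ : GL (Fin (r k.succ)) ℝ).1 *ᵥ ·) h
  · have h : v ᵥ* ((A.1 k.castSucc)⁻¹ : GL (Fin (r k.castSucc)) ℝ).1 = 0 :=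
      hX.eq_zero_of_vecMul_slice k fun i => by
        simpa [slice_theta, Matrix.mul_assoc] using
          congrArg (· ᵥ* ((A.1 k.succ)⁻¹ : GL (Fin (r k.succ)) ℝ).1) (hv i)
    simpa using congrArg (· ᵥ* (A.1 k.castSucc).1) h

theorem update_theta (A : gaugeGroup r) (X ξ : Cores n r) (k : Fin d) :
    Function.update (theta A X) k (theta A ξ k) = theta A (Function.update X k (ξ k)) := by
  funext j
  rcases eq_or_ne j k with rfl | h
  · simp [theta]
  · simp [theta, h]

end Gauge

/-! ### Fibres of `φ` -/

section Fibres

variable {d : ℕ} {n : Fin d → ℕ} {r : Fin (d + 1) → ℕ} {X Y : Cores n r}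

/-- The matrix with rows `X^1(i_1) ⋯ X^k(i_k)`. -/
def leftMat (X : Cores n r) (k : Fin (d + 1)) : Matrix (∀ k : Fin d, Fin (n k)) (Fin (r k)) ℝ :=
  fun i => leftInterface X k i

/-- The matrix with columns `X^{k+1}(i_{k+1}) ⋯ X^d(i_d)`. -/
def rightMat (X : Cores n r) (k : Fin (d + 1)) : Matrix (Fin (r k)) (∀ k : Fin d, Fin (n k)) ℝ :=
  fun l i => rightInterface X k i l

theorem leftMat_mul_rightMat (X : Cores n r) (k : Fin (d + 1)) :
    leftMat X k * rightMat X k = fun i i' => phi X (spliceIndex k i i') := by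
  funext i i'
  rw [phi_spliceIndex]
  rfl

theorem leftMat_succ_update (X : Cores n r) (k : Fin d) (i m) :
    leftMat X k.succ (Function.update i k m) = (leftMat X k.castSucc * slice (X k) m) i := by
  change leftInterface X k.succ _ = leftInterface X k.castSucc i ᵥ* slice (X k) m
  rw [leftInterface_succ, leftInterface_update_index, Function.update_self]

theorem leftMat_last_apply (X : Cores n r) (h1 : r (Fin.last d) = 1) (i l) :
    leftMat X (Fin.last d) i l = phi X i := by
  have : Subsingleton (Fin (r (Fin.last d))) := by rw [h1]; infer_instance
  rw [phi_eq_leftInterface_dotProduct_rightInterface X (Fin.last d), rightInterface_last,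
    dotProduct, Fintype.sum_subsingleton _ l, mul_one]
  rfl

theorem FullRank.leftMat_mul_cancel {m : Type*} (hX : FullRank X) (h0 : r 0 = 1)
    (h1 : 0 < r (Fin.last d)) {k : Fin (d + 1)} {S T : Matrix (Fin (r k)) m ℝ}
    (h : leftMat X k * S = leftMat X k * T) : S = T := by
  obtain ⟨P, hP⟩ := exists_mul_eq_one_of_mulVec_eq_zero (M := leftMat X k) fun v hv =>
    hX.eq_zero_of_leftInterface_dotProduct h0 h1 fun i => congrFun hv i
  simpa only [← Matrix.mul_assoc, hP, Matrix.one_mul] using congrArg (P * ·) h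

theorem FullRank.exists_rightMat_mul_eq_one (hX : FullRank X) (h1 : r (Fin.last d) = 1)
    (k : Fin (d + 1)) :
    ∃ P : Matrix (∀ k : Fin d, Fin (n k)) (Fin (r k)) ℝ, rightMat X k * P = 1 := by
  obtain ⟨P, hP⟩ := exists_mul_eq_one_of_mulVec_eq_zero (M := (rightMat X k)ᵀ) fun v hv =>
    hX.eq_zero_of_dotProduct_rightInterface h1 fun i => by
      rw [mulVec_transpose] at hv
      exact congrFun hv i
  exact ⟨Pᵀ, by rw [← transpose_transpose (rightMat X k), ← transpose_mul, hP, transpose_one]⟩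

theorem FullRank.exists_leftMat_eq_mul (hY : FullRank Y) (h1 : r (Fin.last d) = 1)
    (h : phi X = phi Y) (k : Fin (d + 1)) :
    ∃ A : Matrix (Fin (r k)) (Fin (r k)) ℝ, leftMat Y k = leftMat X k * A := by
  obtain ⟨P, hP⟩ := hY.exists_rightMat_mul_eq_one h1 k
  refine ⟨rightMat X k * P, ?_⟩
  rw [← Matrix.mul_assoc, leftMat_mul_rightMat, h, ← leftMat_mul_rightMat, Matrix.mul_assoc, hP,
    Matrix.mul_one]

theorem FullRank.mul_slice_eq_slice_mul (hX : FullRank X) (h0 : r 0 = 1)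
    (h1 : 0 < r (Fin.last d)) {A : GaugeAlg r} (hA : ∀ k, leftMat Y k = leftMat X k * A k)
    (k : Fin d) (m : Fin (n k)) :
    A k.castSucc * slice (Y k) m = slice (X k) m * A k.succ := by
  refine hX.leftMat_mul_cancel h0 h1 (funext fun i => ?_)
  calc (leftMat X k.castSucc * (A k.castSucc * slice (Y k) m)) i
      = leftMat Y k.succ (Function.update i k m) := by
        rw [← Matrix.mul_assoc, ← hA, leftMat_succ_update]
    _ = leftMat X k.succ (Function.update i k m) ᵥ* A k.succ := by
        rw [hA, mul_apply_eq_vecMul]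
    _ = (leftMat X k.castSucc * (slice (X k) m * A k.succ)) i := by
        rw [leftMat_succ_update, ← mul_apply_eq_vecMul, Matrix.mul_assoc]

theorem FullRank.exists_eq_theta_of_phi_eq (hX : FullRank X) (hY : FullRank Y)
    (h0 : r 0 = 1) (h1 : r (Fin.last d) = 1) (h : phi X = phi Y) :
    ∃ A : gaugeGroup r, Y = TensorTrain.theta A X := by
  have cancel : ∀ {k} {S T : Matrix (Fin (r k)) (Fin (r k)) ℝ},
      leftMat X k * S = leftMat X k * T → S = T := hX.leftMat_mul_cancel h0 (h1 ▸ one_pos)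
  choose A hA using hY.exists_leftMat_eq_mul h1 h
  choose B hB using hX.exists_leftMat_eq_mul h1 h.symm
  have hAB : A * B = 1 := funext fun k => cancel <| by
    rw [Pi.mul_apply, ← Matrix.mul_assoc, ← hA, ← hB, Pi.one_apply, Matrix.mul_one]
  have hA0 : A 0 = 1 := cancel <| by
    rw [← hA, Matrix.mul_one]
    rfl
  have hA1 : A (Fin.last d) = 1 := cancel <| by
    rw [← hA, Matrix.mul_one]
    ext i l
    rw [leftMat_last_apply _ h1, leftMat_last_apply _ h1, h]
  refine ⟨gaugeMk A B hAB hA0 hA1, cores_ext_slice fun k m => ?_⟩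
  rw [theta_gaugeMk, slice_act, Matrix.mul_assoc,
    ← hX.mul_slice_eq_slice_mul h0 (h1 ▸ one_pos) hA, ← Matrix.mul_assoc,
    mul_eq_one_comm.1 (congrFun hAB k.castSucc)]
  exact (Matrix.one_mul _).symm

end Fibres

/-! ### The preconditioned metric -/

section Metric

variable {d : ℕ} {n : Fin d → ℕ} {r : Fin (d + 1) → ℕ}

theorem phi_update_add (X : Cores n r) (k : Fin d) (ζ ζ') :
    phi (Function.update X k (ζ + ζ')) =
      phi (Function.update X k ζ) + phi (Function.update X k ζ') := by
  funext i
  simp only [phi_update, slice_add, add_mulVec, dotProduct_add, Pi.add_apply]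

theorem phi_update_smul (X : Cores n r) (k : Fin d) (c : ℝ) (ζ) :
    phi (Function.update X k (c • ζ)) = c • phi (Function.update X k ζ) := by
  funext i
  simp only [phi_update, slice_smul, smul_mulVec, dotProduct_smul, Pi.smul_apply]

theorem phi_update_spliceIndex (X : Cores n r) (k : Fin d) (ζ i i' m) :
    phi (Function.update X k ζ) (spliceIndex k.castSucc i (Function.update i' k m)) =
      leftInterface X k.castSucc i ⬝ᵥ (slice ζ m *ᵥ rightInterface X k.succ i') := by
  rw [phi_spliceIndex, leftInterface_update, rightInterface_castSucc, rightInterface_update,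
    rightInterface_update_index, Function.update_self, Function.update_self]

theorem FullRank.eq_zero_of_phi_update_eq_zero {X : Cores n r} (hX : FullRank X) (h0 : r 0 = 1)
    (h1 : r (Fin.last d) = 1) {k : Fin d} {ζ} (h : phi (Function.update X k ζ) = 0) : ζ = 0 := by
  refine core_ext_slice fun m => funext fun l =>
    hX.eq_zero_of_dotProduct_rightInterface h1 (k := k.succ) fun i' => ?_
  have hcol : slice ζ m *ᵥ rightInterface X k.succ i' = 0 :=
    hX.eq_zero_of_leftInterface_dotProduct h0 (h1 ▸ one_pos) fun i => by
      rw [← phi_update_spliceIndex, h, Pi.zero_apply]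
  exact congrFun hcol l

theorem frobInner_comm (S T : Tensor n) : frobInner S T = frobInner T S :=
  dotProduct_comm S T

theorem frobInner_self_nonneg (S : Tensor n) : 0 ≤ frobInner S S :=
  Finset.sum_nonneg fun _ _ => mul_self_nonneg _

theorem frobInner_self_eq_zero {S : Tensor n} : frobInner S S = 0 ↔ S = 0 :=
  dotProduct_self_eq_zero

/-- The preconditioned metric at an arbitrary tuple of cores, as a continuous bilinear form. -/
def metricForm (X : Cores n r) : Cores n r →L[ℝ] Cores n r →L[ℝ] ℝ :=
  (LinearMap.mk₂ ℝ
    (fun ξ η => ∑ k : Fin d,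
      frobInner (phi (Function.update X k (ξ k))) (phi (Function.update X k (η k))))
    (fun ξ ξ' η => by
      simp [phi_update_add, frobInner, add_mul, Finset.sum_add_distrib])
    (fun c ξ η => by
      simp [phi_update_smul, frobInner, Finset.mul_sum, mul_assoc])
    (fun ξ η η' => by
      simp [phi_update_add, frobInner, mul_add, Finset.sum_add_distrib])
    (fun c ξ η => by
      simp [phi_update_smul, frobInner, Finset.mul_sum, mul_left_comm])).toContinuousBilinearMap

theorem metricForm_apply (X ξ η : Cores n r) : metricForm X ξ η = ∑ k : Fin d,
    frobInner (phi (Function.update X k (ξ k))) (phi (Function.update X k (η k))) := rfl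

theorem preMetric_eq_metricForm (X : totalSpace n r) (ξ η : Cores n r) :
    preMetric X ξ η = metricForm X.1 ξ η := rfl

theorem metricForm_theta (A : gaugeGroup r) (X ξ η : Cores n r) :
    metricForm (theta A X) (theta A ξ) (theta A η) = metricForm X ξ η := by
  simp only [metricForm_apply, update_theta, phi_theta]

theorem FullRank.posDefForm_metricForm {X : Cores n r} (hX : FullRank X) (h0 : r 0 = 1)
    (h1 : r (Fin.last d) = 1) : PosDefForm (metricForm X) where
  symm ξ η := by simp only [metricForm_apply, frobInner_comm (phi (Function.update X _ (ξ _)))]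
  pos ξ hξ := by
    rw [metricForm_apply]
    refine (Finset.sum_nonneg fun _ _ => frobInner_self_nonneg _).lt_of_ne fun h => hξ ?_
    funext k
    refine hX.eq_zero_of_phi_update_eq_zero h0 h1 (k := k) ?_
    exact frobInner_self_eq_zero.1 ((Finset.sum_eq_zero_iff_of_nonneg
      fun _ _ => frobInner_self_nonneg _).1 h.symm k (Finset.mem_univ k))

theorem contDiff_entry (k : Fin d) (l i l') : ContDiff ℝ ∞ fun X : Cores n r => X k l i l' :=
  contDiff_pi.1 (contDiff_pi.1 (contDiff_pi.1 (contDiff_pi.1 contDiff_id k) l) i) l'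

theorem contDiff_phi : ContDiff ℝ ∞ (phi : Cores n r → Tensor n) :=
  contDiff_pi.2 fun _ => ContDiff.sum fun _ _ => contDiff_prod fun _ _ => contDiff_entry _ _ _ _

theorem contDiff_update_core (k : Fin d) (ζ) :
    ContDiff ℝ ∞ fun X : Cores n r => Function.update X k ζ := by
  refine contDiff_pi.2 fun j => ?_
  rcases eq_or_ne j k with rfl | h
  · simpa only [Function.update_self] using contDiff_const
  · simpa only [Function.update_of_ne h, id_eq] using
    contDiff_pi.1 (contDiff_id (𝕜 := ℝ) (E := Cores n r)) j

theorem contDiff_metricForm : ContDiff ℝ ∞ (metricForm : Cores n r → _) := by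
  have hphi : ∀ k ζ i, ContDiff ℝ ∞ fun X : Cores n r => phi (Function.update X k ζ) i :=
    fun k ζ => contDiff_pi.1 (contDiff_phi.comp (contDiff_update_core k ζ))
  refine contDiff_clm_apply_iff.2 fun ξ => contDiff_clm_apply_iff.2 fun η => ?_
  simp only [metricForm_apply, frobInner]
  exact ContDiff.sum fun k _ => ContDiff.sum fun i _ => (hphi k _ i).mul (hphi k _ i)

end Metric

/-! ### Infinitesimal gauge transformations -/

section Lie

variable {d : ℕ} {n : Fin d → ℕ} {r : Fin (d + 1) → ℕ}

/-- The infinitesimal gauge action of `B` at `X`, the tuple of cores with slices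
`X^k(i) B_k - B_{k-1} X^k(i)`. -/
def infAct (X : Cores n r) (B : GaugeAlg r) : Cores n r :=
  fun k l i l' => (slice (X k) i * B k.succ - B k.castSucc * slice (X k) i) l l'

theorem slice_infAct (X : Cores n r) (B : GaugeAlg r) (k : Fin d) (i : Fin (n k)) :
    slice (infAct X B k) i = slice (X k) i * B k.succ - B k.castSucc * slice (X k) i := rfl

/-- The Lie algebra of the gauge group. -/
def gaugeLie (r : Fin (d + 1) → ℕ) : Submodule ℝ (GaugeAlg r) where
  carrier := {B | B 0 = 0 ∧ B (Fin.last d) = 0}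
  add_mem' := by
    rintro A B ⟨h0, h1⟩ ⟨h2, h3⟩
    simp [h0, h1, h2, h3]
  zero_mem' := by simp
  smul_mem' := by
    rintro c A ⟨h0, h1⟩
    simp [h0, h1]

/-- Elements of the Lie algebra are given by their components in the middle positions. -/
def gaugeLieEquiv (r : Fin (d + 1) → ℕ) : gaugeLie r ≃ₗ[ℝ]
    ∀ k : {k : Fin (d + 1) // k ≠ 0 ∧ k ≠ Fin.last d}, Matrix (Fin (r k)) (Fin (r k)) ℝ where
  toFun B k := B.1 k
  invFun B := ⟨fun k => if h : k ≠ 0 ∧ k ≠ Fin.last d then B ⟨k, h⟩ else 0, by simp, by simp⟩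
  left_inv B := by
    ext1
    funext k
    rcases eq_or_ne k 0 with rfl | h0
    · simp [B.2.1]
    rcases eq_or_ne k (Fin.last d) with rfl | h1
    · simp [B.2.2]
    · simp [h0, h1]
  right_inv B := by
    funext k
    simp [k.2.1, k.2.2]
  map_add' _ _ := rfl
  map_smul' _ _ := rfl

theorem finrank_gaugeLie (r : Fin (d + 1) → ℕ) : Module.finrank ℝ (gaugeLie r) =
    ∑ k ∈ Finset.univ.filter (fun k : Fin (d + 1) => k ≠ 0 ∧ k ≠ Fin.last d), r k ^ 2 := by
  rw [(gaugeLieEquiv r).finrank_eq, Module.finrank_pi_fintype,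
    Finset.sum_subtype (F := inferInstance)
      (p := fun k : Fin (d + 1) => k ≠ 0 ∧ k ≠ Fin.last d) _ (by simp)]
  simp [Module.finrank_matrix, sq]

theorem finrank_cores (n : Fin d → ℕ) (r : Fin (d + 1) → ℕ) :
    Module.finrank ℝ (Cores n r) = ∑ k : Fin d, r k.castSucc * n k * r k.succ := by
  simp [Module.finrank_pi_fintype, mul_assoc]

theorem quotientDim_eq_finrank_sub (n : Fin d → ℕ) (r : Fin (d + 1) → ℕ) :
    quotientDim n r = Module.finrank ℝ (Cores n r) - Module.finrank ℝ (gaugeLie r) := by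
  rw [finrank_cores, finrank_gaugeLie, quotientDim]

/-- The infinitesimal gauge action of the Lie algebra at `X` as a linear map. -/
def infActLin (X : Cores n r) : gaugeLie r →ₗ[ℝ] Cores n r where
  toFun B := infAct X B.1
  map_add' B B' := cores_ext_slice fun k i => by
    simp only [slice_infAct, Pi.add_apply, slice_add, Submodule.coe_add, Matrix.mul_add,
      Matrix.add_mul]
    abel
  map_smul' c B := cores_ext_slice fun k i => by simp [slice_infAct, slice_smul, smul_sub]

theorem FullRank.injective_infActLin {X : Cores n r} (hX : FullRank X) :
    Function.Injective (infActLin X) := by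
  refine (injective_iff_map_eq_zero _).2 fun B hB => Subtype.ext (funext fun k => ?_)
  change B.1 k = 0
  induction k using Fin.induction with
  | zero => exact B.2.1
  | succ k ih =>
    refine Matrix.ext_col fun j => hX.eq_zero_of_slice_mulVec k fun i => ?_
    have h : slice (infAct X B.1 k) i = 0 := congrArg (fun Z : Cores n r => slice (Z k) i) hB
    rw [slice_infAct, ih, Matrix.zero_mul, sub_zero] at h
    funext l
    exact congrFun (congrFun h l) j

theorem FullRank.finrank_range_infActLin_add {X : Cores n r} (hX : FullRank X) :
    Module.finrank ℝ (LinearMap.range (infActLin X)) + quotientDim n r =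
      Module.finrank ℝ (Cores n r) := by
  have hrange := (LinearMap.range (infActLin X)).finrank_le
  rw [LinearMap.finrank_range_of_inj hX.injective_infActLin] at hrange ⊢
  rw [quotientDim_eq_finrank_sub, Nat.add_sub_cancel' hrange]

end Lie

end TensorTrain

section MatrixExp

open scoped Matrix.Norms.Operator

variable {m : Type*} [Fintype m] [DecidableEq m]

theorem contDiff_exp_smul_apply (B : Matrix m m ℝ) (i j : m) :
    ContDiff ℝ ∞ fun t : ℝ => NormedSpace.exp (t • B) i j := by
  have hexp : ContDiff ℝ ∞ (NormedSpace.exp : Matrix m m ℝ → Matrix m m ℝ) :=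
    AnalyticOnNhd.contDiff fun x _ => NormedSpace.exp_analytic (𝕂 := ℝ) x
  exact (Matrix.entryLinearMap ℝ ℝ i j).toContinuousLinearMap.contDiff.comp
    (hexp.comp (contDiff_id.smul contDiff_const))

theorem hasDerivAt_exp_smul_apply_zero (B : Matrix m m ℝ) (i j : m) :
    HasDerivAt (fun t : ℝ => NormedSpace.exp (t • B) i j) (B i j) 0 := by
  have h : HasDerivAt (fun t : ℝ => NormedSpace.exp (t • B)) B 0 :=
    (hasDerivAt_exp_smul_const (𝕂 := ℝ) B 0).congr_deriv (by simp)
  exact (Matrix.entryLinearMap ℝ ℝ i j).toContinuousLinearMap.hasFDerivAt.comp_hasDerivAt 0 h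

theorem exp_mul_exp_neg (B : Matrix m m ℝ) : NormedSpace.exp B * NormedSpace.exp (-B) = 1 := by
  rw [Matrix.exp_neg, Matrix.mul_nonsing_inv _ ((Matrix.isUnit_iff_isUnit_det _).1 B.isUnit_exp)]

end MatrixExp

namespace TensorTrain

section Curves

variable {d : ℕ} {n : Fin d → ℕ} {r : Fin (d + 1) → ℕ}

theorem act_apply (A' A : GaugeAlg r) (Z : Cores n r) (k : Fin d) (l i l') :
    act A' A Z k l i l' = ∑ s, (∑ u, A' k.castSucc l u * Z k u i s) * A k.succ s l' := rfl

theorem contDiffAt_act {V : Type*} [NormedAddCommGroup V] [NormedSpace ℝ V] {x : V}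
    {A' A : V → GaugeAlg r} {Z : V → Cores n r}
    (hA' : ∀ k i j, ContDiffAt ℝ ∞ (fun y => A' y k i j) x)
    (hA : ∀ k i j, ContDiffAt ℝ ∞ (fun y => A y k i j) x) (hZ : ContDiffAt ℝ ∞ Z x) :
    ContDiffAt ℝ ∞ (fun y => act (A' y) (A y) (Z y)) x := by
  have hentry : ∀ k l i l', ContDiffAt ℝ ∞ (fun y => Z y k l i l') x := fun k l i l' =>
    (contDiff_entry k l i l').contDiffAt.comp x hZ
  refine contDiffAt_pi.2 fun k => contDiffAt_pi.2 fun l => contDiffAt_pi.2 fun i =>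
    contDiffAt_pi.2 fun l' => ?_
  simp only [act_apply]
  exact ContDiffAt.sum fun s _ =>
    (ContDiffAt.sum fun u _ => (hA' _ _ _).mul (hentry _ _ _ _)).mul (hA _ _ _)

theorem hasDerivAt_act {A' A : ℝ → GaugeAlg r} {B' B : GaugeAlg r} {t : ℝ} (X : Cores n r)
    (hA' : ∀ k i j, HasDerivAt (fun t => A' t k i j) (B' k i j) t)
    (hA : ∀ k i j, HasDerivAt (fun t => A t k i j) (B k i j) t) :
    HasDerivAt (fun t => act (A' t) (A t) X) (act B' (A t) X + act (A' t) B X) t := by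
  refine hasDerivAt_pi.2 fun k => hasDerivAt_pi.2 fun l => hasDerivAt_pi.2 fun i =>
    hasDerivAt_pi.2 fun l' => ?_
  simp only [Pi.add_apply, act_apply, ← Finset.sum_add_distrib]
  exact HasDerivAt.fun_sum fun s _ =>
    (HasDerivAt.fun_sum fun u _ => (hA' _ _ _).mul_const _).mul (hA _ _ _)

/-- The one-parameter subgroup of the gauge group generated by `B`. -/
def gaugeExp (B : gaugeLie r) (t : ℝ) : gaugeGroup r :=
  gaugeMk (fun k => NormedSpace.exp (t • B.1 k)) (fun k => NormedSpace.exp (t • -B.1 k))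
    (funext fun k => by
      simp only [smul_neg]
      exact exp_mul_exp_neg _)
    (by simp [B.2.1]) (by simp [B.2.2])

theorem theta_gaugeExp (B : gaugeLie r) (t : ℝ) (X : Cores n r) : theta (gaugeExp B t) X =
    act (fun k => NormedSpace.exp (t • -B.1 k)) (fun k => NormedSpace.exp (t • B.1 k)) X :=
  theta_gaugeMk _ _ _ _ _ X

theorem theta_gaugeExp_zero (B : gaugeLie r) (X : Cores n r) : theta (gaugeExp B 0) X = X :=
  cores_ext_slice fun k i => by simp [theta_gaugeExp, slice_act]

theorem contDiff_theta_gaugeExp (B : gaugeLie r) (X : Cores n r) :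
    ContDiff ℝ ∞ fun t => theta (gaugeExp B t) X := by
  simp only [theta_gaugeExp]
  exact contDiff_iff_contDiffAt.2 fun t => contDiffAt_act
    (fun k i j => (contDiff_exp_smul_apply (-B.1 k) i j).contDiffAt)
    (fun k i j => (contDiff_exp_smul_apply (B.1 k) i j).contDiffAt) contDiffAt_const

theorem deriv_theta_gaugeExp (B : gaugeLie r) (X : Cores n r) :
    deriv (fun t => theta (gaugeExp B t) X) 0 = infActLin X B := by
  simp only [theta_gaugeExp]
  refine ((hasDerivAt_act (B' := -B.1) (B := B.1) X
    (fun k i j => hasDerivAt_exp_smul_apply_zero (-B.1 k) i j)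
    fun k i j => hasDerivAt_exp_smul_apply_zero (B.1 k) i j).deriv).trans ?_
  refine cores_ext_slice fun k i => ?_
  change _ = slice (infAct X B.1 k) i
  simp [slice_add, slice_act, slice_infAct, sub_eq_neg_add]

end Curves

end TensorTrain

section SmoothMatrix

variable {V m : Type*} [NormedAddCommGroup V] [NormedSpace ℝ V] [Fintype m] [DecidableEq m]
  {x : V} {A : V → Matrix m m ℝ}

theorem contDiffAt_matrix_det (hA : ∀ i j, ContDiffAt ℝ ∞ (fun y => A y i j) x) :
    ContDiffAt ℝ ∞ (fun y => (A y).det) x := by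
  simp only [Matrix.det_apply']
  exact ContDiffAt.sum fun σ _ => contDiffAt_const.mul (contDiffAt_prod fun i _ => hA _ _)

theorem contDiffAt_matrix_inv_apply (hA : ∀ i j, ContDiffAt ℝ ∞ (fun y => A y i j) x)
    (hx : IsUnit (A x).det) (i j : m) : ContDiffAt ℝ ∞ (fun y => (A y)⁻¹ i j) x := by
  simp only [Matrix.inv_def, Ring.inverse_eq_inv', Matrix.smul_apply, smul_eq_mul,
    Matrix.adjugate_apply]
  refine ((contDiffAt_matrix_det hA).inv hx.ne_zero).mul (contDiffAt_matrix_det fun i' j' => ?_)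
  by_cases h : i' = j
  · simpa only [h, Matrix.updateRow_self] using contDiffAt_const
  · simpa only [Matrix.updateRow_ne h] using hA i' j'

end SmoothMatrix

theorem exists_clm_section_ker {V W F : Type*} [NormedAddCommGroup V] [NormedSpace ℝ V]
    [FiniteDimensional ℝ V] [AddCommGroup W] [Module ℝ W] [NormedAddCommGroup F] [NormedSpace ℝ F]
    [FiniteDimensional ℝ F] (N : V →ₗ[ℝ] W)
    (h : Module.finrank ℝ (LinearMap.ker N) = Module.finrank ℝ F) :
    ∃ (C : V →L[ℝ] F) (S : F →L[ℝ] V),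
      (∀ w, C (S w) = w) ∧ (∀ w, N (S w) = 0) ∧ ∀ ξ, N ξ = 0 → S (C ξ) = ξ := by
  let e : LinearMap.ker N ≃ₗ[ℝ] F := LinearEquiv.ofFinrankEq _ _ h
  obtain ⟨P, hP⟩ := (LinearMap.ker N).subtype.exists_leftInverse_of_injective
    (LinearMap.ker_eq_bot.2 Subtype.val_injective)
  have hP' : ∀ ζ : LinearMap.ker N, P ζ = ζ := LinearMap.congr_fun hP
  refine ⟨(e.toLinearMap ∘ₗ P).toContinuousLinearMap,
    ((LinearMap.ker N).subtype ∘ₗ e.symm.toLinearMap).toContinuousLinearMap,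
    fun w => ?_, fun w => (e.symm w).2, fun ξ hξ => ?_⟩
  · simp [hP']
  · simp [hP' ⟨ξ, hξ⟩]

namespace TensorTrain

open Matrix

/-! ### Normal forms -/

section NormalForm

variable {d : ℕ} {n : Fin d → ℕ} {r : Fin (d + 1) → ℕ}

/-- Families of matrices `Q_k(i)` of size `r_k × r_{k-1}`, which serve as left inverses of left
unfoldings. -/
abbrev LeftInverses (n : Fin d → ℕ) (r : Fin (d + 1) → ℕ) : Type :=
  ∀ k : Fin d, Fin (n k) → Matrix (Fin (r k.succ)) (Fin (r k.castSucc)) ℝ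

/-- `Q` is a left inverse of the left unfoldings of `X`. -/
def IsLeftInverse (Q : LeftInverses n r) (X : Cores n r) : Prop :=
  ∀ k, ∑ i, Q k i * slice (X k) i = 1

theorem FullRank.exists_isLeftInverse {X : Cores n r} (hX : FullRank X) :
    ∃ Q : LeftInverses n r, IsLeftInverse Q X := by
  have h : ∀ k, ∃ P : Matrix (Fin (r k.succ)) (Fin (r k.castSucc) × Fin (n k)) ℝ,
      P * leftUnfold (X k) = 1 := fun k => exists_mul_eq_one_of_mulVec_eq_zero fun v hv =>
      hX.eq_zero_of_slice_mulVec k ((mulVec_leftUnfold_eq_zero_iff _ _).1 hv)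
  choose P hP using h
  refine ⟨fun k i => (P k).submatrix id (·, i), fun k => ?_⟩
  rw [← hP]
  ext l l'
  simp only [Matrix.sum_apply, Matrix.mul_apply, Matrix.submatrix_apply, leftUnfold, slice, id,
    Fintype.sum_prod_type_right]

/-- The linear map `Z ↦ (∑_i Q_k(i) Z^k(i))_k`, restricted to the middle positions. -/
def contractLin (Q : LeftInverses n r) : Cores n r →ₗ[ℝ] gaugeLie r where
  toFun Z := ⟨Fin.cases 0 fun k => if k.succ = Fin.last d then 0 else ∑ i, Q k i * slice (Z k) i,
    rfl, by
      cases d with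
      | zero => rfl
      | succ d => simp [← Fin.succ_last]⟩
  map_add' Z Z' := by
    ext1
    funext k
    cases k using Fin.cases with
    | zero => exact (add_zero 0).symm
    | succ k =>
      simp only [Fin.cases_succ, Submodule.coe_add, Pi.add_apply]
      split_ifs
      · simp
      · simp [slice_add, Matrix.mul_add, Finset.sum_add_distrib]
  map_smul' c Z := by
    ext1
    funext k
    cases k using Fin.cases with
    | zero => exact (smul_zero c).symm
    | succ k =>
      simp only [Fin.cases_succ, Submodule.coe_smul, Pi.smul_apply, RingHom.id_apply]
      split_ifs
      · simp
      · simp [slice_smul, Finset.smul_sum]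

theorem contractLin_succ (Q : LeftInverses n r) (Z : Cores n r) (k : Fin d) :
    (contractLin Q Z).1 k.succ =
      if k.succ = Fin.last d then 0 else ∑ i, Q k i * slice (Z k) i := rfl

theorem contractLin_congr {Q : LeftInverses n r} {Z Z' : Cores n r}
    (h : ∀ k : Fin d, k.succ ≠ Fin.last d →
      ∑ i, Q k i * slice (Z k) i = ∑ i, Q k i * slice (Z' k) i) :
    contractLin Q Z = contractLin Q Z' := by
  ext1
  funext k
  cases k using Fin.cases with
  | zero => rfl
  | succ k =>
    rw [contractLin_succ, contractLin_succ]
    split_ifs with hk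
    · rfl
    · exact h k hk

variable {Q : LeftInverses n r} {X Y Z : Cores n r}

theorem IsLeftInverse.surjective_contractLin (hQ : IsLeftInverse Q X) :
    Function.Surjective (contractLin Q) := fun B => by
  refine ⟨act 1 B.1 X, Subtype.ext (funext fun k => ?_)⟩
  cases k using Fin.cases with
  | zero => exact B.2.1.symm
  | succ k =>
    rw [contractLin_succ]
    split_ifs with hk
    · rw [hk, B.2.2]
    · simp only [slice_act, Pi.one_apply, Matrix.one_mul, ← Matrix.mul_assoc,
        ← Matrix.sum_mul, hQ k]

theorem IsLeftInverse.finrank_ker_contractLin (hQ : IsLeftInverse Q X) :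
    Module.finrank ℝ (LinearMap.ker (contractLin Q)) = quotientDim n r := by
  rw [quotientDim_eq_finrank_sub, ← (contractLin Q).finrank_range_add_finrank_ker,
    LinearMap.range_eq_top.2 hQ.surjective_contractLin, finrank_top, Nat.add_sub_cancel_left]

/-- The gauge factors of `X` relative to `Q`: the family `G` with `G_0 = G_d = 1` and
`G_k = ∑_i Q_k(i) G_{k-1} X^k(i)` in the middle positions. Gauging `X` by `G⁻¹` turns `Q` into a
left inverse of `X` in the middle positions. -/
def gaugeFactor (Q : LeftInverses n r) (X : Cores n r) : GaugeAlg r :=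
  Fin.induction 1 fun k G =>
    if k.succ = Fin.last d then 1 else ∑ i, Q k i * (G * slice (X k) i)

theorem gaugeFactor_zero (Q : LeftInverses n r) (X : Cores n r) : gaugeFactor Q X 0 = 1 := rfl

theorem gaugeFactor_succ (Q : LeftInverses n r) (X : Cores n r) (k : Fin d) :
    gaugeFactor Q X k.succ = if k.succ = Fin.last d then 1 else
      ∑ i, Q k i * (gaugeFactor Q X k.castSucc * slice (X k) i) := rfl

theorem gaugeFactor_last (Q : LeftInverses n r) (X : Cores n r) :
    gaugeFactor Q X (Fin.last d) = 1 := by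
  cases d with
  | zero => rfl
  | succ d => rw [← Fin.succ_last, gaugeFactor_succ, if_pos (Fin.succ_last d)]

theorem gaugeFactor_theta (Q : LeftInverses n r) (A : gaugeGroup r) (X : Cores n r)
    (k : Fin (d + 1)) : gaugeFactor Q (theta A X) k = gaugeFactor Q X k * (A.1 k).1 := by
  induction k using Fin.induction with
  | zero => simp [gaugeFactor_zero, A.2.1]
  | succ k ih =>
    rw [gaugeFactor_succ, gaugeFactor_succ, ih]
    split_ifs with hk
    · rw [hk, A.2.2, Units.val_one, Matrix.mul_one]
    · simp [slice_theta, Matrix.sum_mul, Matrix.mul_assoc]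

theorem IsLeftInverse.gaugeFactor_eq_one (hQ : IsLeftInverse Q X)
    (h : contractLin Q Y = contractLin Q X) : gaugeFactor Q Y = 1 := by
  funext k
  induction k using Fin.induction with
  | zero => rfl
  | succ k ih =>
    have hk := congrFun (congrArg Subtype.val h) k.succ
    rw [contractLin_succ, contractLin_succ, hQ k] at hk
    rw [gaugeFactor_succ]
    split_ifs at hk ⊢ with hlast
    · rfl
    · simpa only [ih, Pi.one_apply, Matrix.one_mul] using hk

theorem contDiff_gaugeFactor (Q : LeftInverses n r) (k : Fin (d + 1)) (l l') :
    ContDiff ℝ ∞ fun X => gaugeFactor Q X k l l' := by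
  induction k using Fin.induction with
  | zero => exact contDiff_const
  | succ k ih =>
    simp only [gaugeFactor_succ]
    split_ifs
    · exact contDiff_const
    · simp only [Matrix.sum_apply, Matrix.mul_apply]
      exact ContDiff.sum fun i _ => ContDiff.sum fun s _ => contDiff_const.mul <|
        ContDiff.sum fun u _ => (ih s u).mul (contDiff_entry _ _ _ _)

/-- The normal form of `X` relative to `Q`, which is the gauge transform of `X` by `G⁻¹` with `G`
the gauge factors of `X`, provided that these are invertible. -/
def normalForm (Q : LeftInverses n r) (X : Cores n r) : Cores n r :=
  act (gaugeFactor Q X) (fun k => (gaugeFactor Q X k)⁻¹) X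

theorem normalForm_theta (Q : LeftInverses n r) (A : gaugeGroup r) (X : Cores n r) :
    normalForm Q (theta A X) = normalForm Q X :=
  cores_ext_slice fun k i => by
    simp [normalForm, slice_act, gaugeFactor_theta, slice_theta, Matrix.mul_inv_rev,
      Matrix.mul_assoc, ← Matrix.coe_units_inv, ← Matrix.mul_assoc (A.1 k.castSucc).1]

theorem IsLeftInverse.normalForm_eq_self (hQ : IsLeftInverse Q X)
    (h : contractLin Q Y = contractLin Q X) : normalForm Q Y = Y :=
  cores_ext_slice fun k i => by
    simp [normalForm, slice_act, hQ.gaugeFactor_eq_one h]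

theorem exists_normalForm_eq_theta (hX : ∀ k, IsUnit (gaugeFactor Q X k).det) :
    ∃ A : gaugeGroup r, normalForm Q X = theta A X :=
  ⟨gaugeMk (fun k => (gaugeFactor Q X k)⁻¹) (gaugeFactor Q X)
      (funext fun k => Matrix.nonsing_inv_mul _ (hX k))
      (by simp [gaugeFactor_zero]) (by simp [gaugeFactor_last]),
    (theta_gaugeMk _ _ _ _ _ X).symm⟩

theorem IsLeftInverse.contractLin_normalForm (hQ : IsLeftInverse Q X)
    (hY : ∀ k, IsUnit (gaugeFactor Q Y k).det) :
    contractLin Q (normalForm Q Y) = contractLin Q X := by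
  refine contractLin_congr fun k hk => ?_
  have hG : ∑ i, Q k i * (gaugeFactor Q Y k.castSucc * slice (Y k) i) = gaugeFactor Q Y k.succ :=
    (if_neg hk).symm
  simp only [normalForm, slice_act, ← Matrix.mul_assoc] at hG ⊢
  rw [hQ k, ← Matrix.sum_mul, hG, Matrix.mul_nonsing_inv _ (hY k.succ)]

theorem contDiffAt_normalForm (Q : LeftInverses n r)
    (hX : ∀ k, IsUnit (gaugeFactor Q X k).det) : ContDiffAt ℝ ∞ (normalForm Q) X :=
  contDiffAt_act (fun k i j => (contDiff_gaugeFactor Q k i j).contDiffAt)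
    (fun k i j => contDiffAt_matrix_inv_apply
      (fun i j => (contDiff_gaugeFactor Q k i j).contDiffAt) (hX k) i j) contDiffAt_id

theorem isOpen_forall_isUnit_det_gaugeFactor (Q : LeftInverses n r) :
    IsOpen {X | ∀ k, IsUnit (gaugeFactor Q X k).det} := by
  simp only [isUnit_iff_ne_zero, Set.ofPred_forall]
  refine isOpen_iInter_of_finite fun k => isOpen_ne_fun ?_ continuous_const
  exact continuous_iff_continuousAt.2 fun X => (contDiffAt_matrix_det fun i j =>
    (contDiff_gaugeFactor Q k i j).contDiffAt).continuousAt

end NormalForm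

end TensorTrain

theorem hasMFDerivAt_subtypeVal_comp_iff {E E' H N : Type*} [NormedAddCommGroup E] [NormedSpace ℝ E]
    [NormedAddCommGroup E'] [NormedSpace ℝ E'] [TopologicalSpace H] [TopologicalSpace N]
    [ChartedSpace H N] {I : ModelWithCorners ℝ E' H} {U : TopologicalSpace.Opens E} {f : N → U}
    {x : N} {f'} : HasMFDerivAt I 𝓘(ℝ, E) (Subtype.val ∘ f) x f' ↔ HasMFDerivAt I 𝓘(ℝ, E) f x f' :=
  and_congr_left' (Topology.IsInducing.subtypeVal.continuousAt_iff).symm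

namespace TensorTrain

section Quotient

variable {d : ℕ} {n : Fin d → ℕ} {r : Fin (d + 1) → ℕ}

theorem proj_eq_iff {X Y : totalSpace n r} : proj X = proj Y ↔ phi X.1 = phi Y.1 :=
  Quotient.eq (r := equivSetoid n r)

theorem proj_eq_iff_theta (h0 : r 0 = 1) (h1 : r (Fin.last d) = 1) {X Y : totalSpace n r} :
    proj X = proj Y ↔ ∃ A : gaugeGroup r, Y.1 = theta A X.1 := by
  rw [proj_eq_iff]
  refine ⟨X.2.exists_eq_theta_of_phi_eq Y.2 h0 h1, ?_⟩
  rintro ⟨A, hA⟩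
  rw [hA, phi_theta]

theorem proj_surjective : Function.Surjective (proj : totalSpace n r → QuotientSpace n r) :=
  Quotient.mk_surjective

theorem isQuotientMap_proj :
    Topology.IsQuotientMap (proj : totalSpace n r → QuotientSpace n r) :=
  isQuotientMap_quot_mk

/-- The gauge transformation `θ_A` as a self-map of the total space. -/
def thetaTotal (A : gaugeGroup r) (X : totalSpace n r) : totalSpace n r :=
  ⟨theta A X.1, X.2.theta A⟩

theorem proj_thetaTotal (A : gaugeGroup r) (X : totalSpace n r) :
    proj (thetaTotal A X) = proj X :=
  proj_eq_iff.2 (phi_theta A X.1)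

theorem hasMFDerivAt_thetaTotal (A : gaugeGroup r) (X : totalSpace n r) :
    HasMFDerivAt 𝓘(ℝ, Cores n r) 𝓘(ℝ, Cores n r) (thetaTotal A) X
      (thetaLin A).toContinuousLinearMap :=
  hasMFDerivAt_subtypeVal_comp_iff.1 <|
    (thetaLin A).toContinuousLinearMap.hasMFDerivAt.comp X <|
      hasMFDerivAt_subtypeVal_comp_iff.2 (hasMFDerivAt_id X)

theorem isOpenMap_proj (h0 : r 0 = 1) (h1 : r (Fin.last d) = 1) :
    IsOpenMap (proj : totalSpace n r → QuotientSpace n r) := by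
  intro U hU
  have hsat : proj ⁻¹' (proj '' U) = ⋃ A : gaugeGroup r, thetaTotal A ⁻¹' U := by
    ext X
    simp only [Set.mem_preimage, Set.mem_image, Set.mem_iUnion]
    constructor
    · rintro ⟨Y, hY, hYX⟩
      obtain ⟨A, hA⟩ := (proj_eq_iff_theta h0 h1).1 hYX.symm
      obtain rfl : Y = thetaTotal A X := Subtype.ext hA
      exact ⟨A, hY⟩
    · rintro ⟨A, hA⟩
      exact ⟨_, hA, proj_thetaTotal A X⟩
  rw [← isQuotientMap_proj.isOpen_preimage, hsat]
  exact isOpen_iUnion fun A => hU.preimage <| continuous_iff_continuousAt.2 fun X =>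
    (hasMFDerivAt_thetaTotal A X).continuousAt

theorem t2Space_quotientSpace (n : Fin d → ℕ) (r : Fin (d + 1) → ℕ) :
    T2Space (QuotientSpace n r) := by
  let f : QuotientSpace n r → Tensor n :=
    Quotient.lift (s := equivSetoid n r) (fun X => phi X.1) fun _ _ h => h
  have hf : Continuous f :=
    isQuotientMap_proj.continuous_iff.2 (contDiff_phi.continuous.comp continuous_subtype_val)
  have hinj : Function.Injective f := by
    intro p q hpq
    obtain ⟨X, rfl⟩ := proj_surjective p
    obtain ⟨Y, rfl⟩ := proj_surjective q
    exact proj_eq_iff.2 hpq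
  exact T2Space.of_injective_continuous hinj hf

theorem secondCountable_quotientSpace (h0 : r 0 = 1) (h1 : r (Fin.last d) = 1) :
    SecondCountableTopology (QuotientSpace n r) :=
  isQuotientMap_proj.secondCountableTopology (isOpenMap_proj h0 h1)

end Quotient

/-! ### The quotient manifold -/

section Slice

variable {d : ℕ} {n : Fin d → ℕ} {r : Fin (d + 1) → ℕ} {F : Type*} [NormedAddCommGroup F]
  [NormedSpace ℝ F]

open Classical in
/-- The affine map `w ↦ X + S w` as a map into the total space, where it takes the junk value `X`
at the points `w` at which `X + S w` is not of full rank. -/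
def affineSection (X : totalSpace n r) (S : F →L[ℝ] Cores n r) (w : F) : totalSpace n r :=
  if h : FullRank (X.1 + S w) then ⟨X.1 + S w, h⟩ else X

variable {X Y : totalSpace n r} {S : F →L[ℝ] Cores n r} {w : F}

theorem coe_affineSection (h : FullRank (X.1 + S w)) :
    (affineSection X S w : Cores n r) = X.1 + S w :=
  congrArg Subtype.val (dif_pos h)

theorem isOpen_fullRank_affine (X : totalSpace n r) (S : F →L[ℝ] Cores n r) :
    IsOpen {w | FullRank (X.1 + S w)} :=
  (isOpen_fullRank n r).preimage (f := fun w => X.1 + S w) (by fun_prop)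

theorem contMDiffOn_affineSection (X : totalSpace n r) (S : F →L[ℝ] Cores n r) :
    ContMDiffOn 𝓘(ℝ, F) 𝓘(ℝ, Cores n r) ∞ (affineSection X S) {w | FullRank (X.1 + S w)} := by
  intro w hw
  have hS : ContMDiffAt 𝓘(ℝ, F) 𝓘(ℝ, Cores n r) ∞ (fun w => X.1 + S w) w :=
    (contDiff_const.add S.contDiff).contMDiff w
  refine ((ContMDiffAt.subtypeVal_comp_iff _ _ _).1
    (hS.congr_of_eventuallyEq ?_)).contMDiffWithinAt
  filter_upwards [(isOpen_fullRank_affine X S).mem_nhds hw] with w' hw'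
  exact coe_affineSection hw'

variable {Q : LeftInverses n r} {C : Cores n r →L[ℝ] F}

theorem isUnit_det_gaugeFactor_theta (A : gaugeGroup r) {X : Cores n r}
    (hX : ∀ k, IsUnit (gaugeFactor Q X k).det) (k) :
    IsUnit (gaugeFactor Q (theta A X) k).det := by
  rw [gaugeFactor_theta, Matrix.det_mul]
  exact (hX k).mul ((Matrix.isUnit_iff_isUnit_det _).1 (A.1 k).isUnit)

theorem IsLeftInverse.add_section_normalForm (hQ : IsLeftInverse Q X.1)
    (hSC : ∀ ξ, contractLin Q ξ = 0 → S (C ξ) = ξ)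
    (hY : ∀ k, IsUnit (gaugeFactor Q Y.1 k).det) :
    X.1 + S (C (normalForm Q Y.1 - X.1)) = normalForm Q Y.1 := by
  rw [hSC _ (by rw [map_sub, hQ.contractLin_normalForm hY, sub_self]), add_sub_cancel]

theorem IsLeftInverse.fullRank_add_section_normalForm (hQ : IsLeftInverse Q X.1)
    (hSC : ∀ ξ, contractLin Q ξ = 0 → S (C ξ) = ξ)
    (hY : ∀ k, IsUnit (gaugeFactor Q Y.1 k).det) :
    FullRank (X.1 + S (C (normalForm Q Y.1 - X.1))) := by
  obtain ⟨A, hA⟩ := exists_normalForm_eq_theta hY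
  rw [hQ.add_section_normalForm hSC hY, hA]
  exact FullRank.theta A Y.2

theorem IsLeftInverse.proj_affineSection (hQ : IsLeftInverse Q X.1)
    (hSC : ∀ ξ, contractLin Q ξ = 0 → S (C ξ) = ξ)
    (hY : ∀ k, IsUnit (gaugeFactor Q Y.1 k).det) :
    proj (affineSection X S (C (normalForm Q Y.1 - X.1))) = proj Y := by
  obtain ⟨A, hA⟩ := exists_normalForm_eq_theta hY
  rw [proj_eq_iff, coe_affineSection (hQ.fullRank_add_section_normalForm hSC hY),
    hQ.add_section_normalForm hSC hY, hA, phi_theta]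

theorem contractLin_affineSection (hNS : ∀ w, contractLin Q (S w) = 0)
    (hw : FullRank (X.1 + S w)) :
    contractLin Q (affineSection X S w).1 = contractLin Q X.1 := by
  rw [coe_affineSection hw, map_add, hNS, add_zero]

/-- The slice at `X` given by the affine space `X + ker (contractLin Q)`, which the normal form
meets every nearby orbit in. Linear coordinates on it are given by `C` and `S`. -/
def affineSlice (h0 : r 0 = 1) (h1 : r (Fin.last d) = 1) (hQ : IsLeftInverse Q X.1)
    (hCS : ∀ w, C (S w) = w) (hNS : ∀ w, contractLin Q (S w) = 0)
    (hSC : ∀ ξ, contractLin Q ξ = 0 → S (C ξ) = ξ) :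
    LocalSlice 𝓘(ℝ, Cores n r) F (proj : totalSpace n r → QuotientSpace n r) X where
  dom := {Y | ∀ k, IsUnit (gaugeFactor Q Y.1 k).det}
  coord Y := C (normalForm Q Y.1 - X.1)
  img := {w | FullRank (X.1 + S w)}
  sec := affineSection X S
  isOpen_dom := (isOpen_forall_isUnit_det_gaugeFactor Q).preimage continuous_subtype_val
  mem_dom := fun k => by simp [hQ.gaugeFactor_eq_one rfl]
  mem_dom_of_eq h hY := by
    obtain ⟨A, hA⟩ := (proj_eq_iff_theta h0 h1).1 h
    exact fun k => hA ▸ isUnit_det_gaugeFactor_theta A hY k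
  contMDiffOn_coord Y hY := (contMDiffAt_subtype_iff.2 (C.contDiff.contDiffAt.comp Y.1
    ((contDiffAt_normalForm Q hY).sub contDiffAt_const)).contMDiffAt).contMDiffWithinAt
  coord_congr h _ := by
    obtain ⟨A, hA⟩ := (proj_eq_iff_theta h0 h1).1 h
    rw [hA, normalForm_theta]
  isOpen_img := isOpen_fullRank_affine X S
  contMDiffOn_sec := contMDiffOn_affineSection X S
  mapsTo_coord _ hY := hQ.fullRank_add_section_normalForm hSC hY
  mapsTo_sec w hw k := by
    simp [hQ.gaugeFactor_eq_one (contractLin_affineSection hNS hw)]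
  coord_sec hw := by
    rw [hQ.normalForm_eq_self (contractLin_affineSection hNS hw), coe_affineSection hw,
      add_sub_cancel_left, hCS]
  apply_sec_coord hY := hQ.proj_affineSection hSC hY
  sec_coord := Subtype.ext <| by
    have hzero : C (normalForm Q X.1 - X.1) = 0 := by
      rw [hQ.normalForm_eq_self rfl, sub_self, map_zero]
    have hX : X.1 + S 0 = X.1 := by rw [map_zero, add_zero]
    rw [hzero, coe_affineSection (hX.symm ▸ X.2), hX]

theorem nonempty_localSlice (h0 : r 0 = 1) (h1 : r (Fin.last d) = 1) (X : totalSpace n r) :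
    Nonempty (LocalSlice 𝓘(ℝ, Cores n r) (QuotientModel n r)
      (proj : totalSpace n r → QuotientSpace n r) X) := by
  obtain ⟨Q, hQ⟩ := FullRank.exists_isLeftInverse X.2
  obtain ⟨C, S, hCS, hNS, hSC⟩ := exists_clm_section_ker (F := QuotientModel n r) (contractLin Q)
    (by rw [hQ.finrank_ker_contractLin, finrank_euclideanSpace_fin])
  exact ⟨affineSlice h0 h1 hQ hCS hNS hSC⟩

theorem exists_isQuotientManifold (h0 : r 0 = 1) (h1 : r (Fin.last d) = 1) :
    ∃ _ : ChartedSpace (QuotientModel n r) (QuotientSpace n r), IsQuotientManifold n r := by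
  obtain ⟨c, hmfd, hsmooth, hsurj⟩ := exists_chartedSpace_of_localSlice isQuotientMap_proj
    fun X => (nonempty_localSlice h0 h1 X).some
  exact ⟨c, hmfd, hsmooth, hsurj⟩

end Slice

/-! ### Horizontal lifts -/

section Structure

variable {d : ℕ} {n : Fin d → ℕ} {r : Fin (d + 1) → ℕ}

theorem mem_equivClass_theta (A : gaugeGroup r) (X : totalSpace n r) :
    theta A X.1 ∈ equivClass X :=
  ⟨X.2.theta A, proj_thetaTotal A X⟩

theorem infActLin_mem_verticalSpace (X : totalSpace n r) (B : gaugeLie r) :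
    infActLin X.1 B ∈ verticalSpace X :=
  ⟨fun t => theta (gaugeExp B t) X.1, contDiff_theta_gaugeExp B X.1,
    fun t => mem_equivClass_theta (gaugeExp B t) X, theta_gaugeExp_zero B X.1,
    deriv_theta_gaugeExp B X.1⟩

theorem contMDiff_metricForm : ContMDiff 𝓘(ℝ, Cores n r)
    𝓘(ℝ, Cores n r →L[ℝ] Cores n r →L[ℝ] ℝ) ∞ fun X : totalSpace n r => metricForm X.1 :=
  fun _ => contMDiffAt_subtype_iff.2
    (contDiff_metricForm (n := n) (r := r)).contDiffAt.contMDiffAt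

variable [ChartedSpace (QuotientModel n r) (QuotientSpace n r)]

/-- The differential `Dπ(X)`. -/
abbrev projDeriv (X : totalSpace n r) : Cores n r →L[ℝ] QuotientModel n r :=
  modelDeriv (Cores n r) (QuotientModel n r) proj X

theorem IsQuotientManifold.hasMFDerivAt_proj (h : IsQuotientManifold n r) (X : totalSpace n r) :
    HasMFDerivAt 𝓘(ℝ, Cores n r) 𝓘(ℝ, QuotientModel n r) proj X (projDeriv X) :=
  (h.contMDiff_proj.mdifferentiableAt (by simp)).hasMFDerivAt

theorem IsQuotientManifold.surjective_projDeriv (h : IsQuotientManifold n r)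
    (X : totalSpace n r) : Function.Surjective (projDeriv X) :=
  h.surjective_mfderiv_proj X

theorem IsQuotientManifold.projDeriv_thetaTotal (h : IsQuotientManifold n r) (A : gaugeGroup r)
    (X : totalSpace n r) (ξ : Cores n r) :
    projDeriv (thetaTotal A X) (theta A ξ) = projDeriv X ξ := by
  have hcomp := (h.hasMFDerivAt_proj (thetaTotal A X)).comp X (hasMFDerivAt_thetaTotal A X)
  rw [show proj ∘ thetaTotal A = (proj : totalSpace n r → _) from
    funext (proj_thetaTotal A)] at hcomp
  exact DFunLike.congr_fun (hasMFDerivAt_unique hcomp (h.hasMFDerivAt_proj X)) ξ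

theorem IsQuotientManifold.projDeriv_eq_zero_of_mem_verticalSpace (h : IsQuotientManifold n r)
    {X : totalSpace n r} {v : Cores n r} (hv : v ∈ verticalSpace X) : projDeriv X v = 0 := by
  obtain ⟨γ, hγ, hγX, hγ0, rfl⟩ := hv
  choose hmem hproj using hγX
  let c (t : ℝ) : totalSpace n r := ⟨γ t, hmem t⟩
  have hc : HasMFDerivAt 𝓘(ℝ, ℝ) 𝓘(ℝ, Cores n r) c 0 (fderiv ℝ γ 0) :=
    hasMFDerivAt_subtypeVal_comp_iff.1
      (hγ.differentiable (by simp) 0).hasFDerivAt.hasMFDerivAt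
  obtain rfl : c 0 = X := Subtype.ext hγ0
  have hcomp := (h.hasMFDerivAt_proj (c 0)).comp 0 hc
  rw [show proj ∘ c = fun _ => proj (c 0) from funext hproj] at hcomp
  exact DFunLike.congr_fun (hasMFDerivAt_unique hcomp (hasMFDerivAt_const _ _)) (1 : ℝ)

theorem IsQuotientManifold.mem_verticalSpace_iff (h : IsQuotientManifold n r)
    {X : totalSpace n r} {v : Cores n r} : v ∈ verticalSpace X ↔ projDeriv X v = 0 := by
  refine ⟨h.projDeriv_eq_zero_of_mem_verticalSpace, fun hv => ?_⟩
  let D := (projDeriv X).toLinearMap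
  have hle : LinearMap.range (infActLin X.1) ≤ LinearMap.ker D := by
    rintro _ ⟨B, rfl⟩
    exact h.projDeriv_eq_zero_of_mem_verticalSpace (infActLin_mem_verticalSpace X B)
  have hrange : LinearMap.range (infActLin X.1) = LinearMap.ker D := by
    refine Submodule.eq_of_le_of_finrank_eq hle ?_
    have hD := D.finrank_range_add_finrank_ker
    rw [LinearMap.range_eq_top.2 (h.surjective_projDeriv X), finrank_top,
      finrank_euclideanSpace_fin] at hD
    have hX := FullRank.finrank_range_infActLin_add X.2
    omega
  obtain ⟨B, rfl⟩ := hrange.ge hv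
  exact infActLin_mem_verticalSpace X B

theorem IsQuotientManifold.mem_horizontalSpace_iff (h : IsQuotientManifold n r)
    {X : totalSpace n r} {ξ : Cores n r} :
    ξ ∈ horizontalSpace X ↔ IsHorizontal (metricForm X.1) (projDeriv X) ξ :=
  forall_congr' fun _ => imp_congr_left h.mem_verticalSpace_iff

section HorizontalLift

variable {q : QuotientSpace n r} {ξ η : TangentSpace 𝓘(ℝ, QuotientModel n r) q}
  {X Y : totalSpace n r} {A : gaugeGroup r}

theorem IsQuotientManifold.isHorizontalLift_iff (h : IsQuotientManifold n r) {ζ : Cores n r} :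
    IsHorizontalLift q ξ X ζ ↔ IsHorizontal (metricForm X.1) (projDeriv X) ζ ∧
      proj X = q ∧ projDeriv X ζ = (ξ : QuotientModel n r) :=
  and_congr h.mem_horizontalSpace_iff tangentMap_eq_mk_iff

theorem existsUnique_horizontalLift (h0 : r 0 = 1) (h1 : r (Fin.last d) = 1)
    (h : IsQuotientManifold n r) (q : QuotientSpace n r)
    (ξ : TangentSpace 𝓘(ℝ, QuotientModel n r) q) (X : totalSpace n r) (hX : proj X = q) :
    ∃! ζ, IsHorizontalLift q ξ X ζ := by
  have hpos : PosDefForm (metricForm X.1) := FullRank.posDefForm_metricForm X.2 h0 h1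
  simp only [h.isHorizontalLift_iff]
  obtain ⟨ζ, hζ, hζξ⟩ := exists_isHorizontal hpos (h.surjective_projDeriv X)
    (ξ : QuotientModel n r)
  exact ⟨ζ, ⟨hζ, hX, hζξ⟩, fun η ⟨hη, _, hηξ⟩ => hη.eq_of_apply_eq hpos hζ (hηξ.trans hζξ.symm)⟩

theorem IsQuotientManifold.isHorizontalLift_thetaTotal (h : IsQuotientManifold n r)
    {ζ : Cores n r} (hζ : IsHorizontalLift q ξ X ζ) (A : gaugeGroup r) :
    IsHorizontalLift q ξ (thetaTotal A X) (theta A ζ) := by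
  rw [h.isHorizontalLift_iff] at hζ ⊢
  obtain ⟨hhor, hq, hξ⟩ := hζ
  refine ⟨fun v hv => ?_, (proj_thetaTotal A X).trans hq, by rw [h.projDeriv_thetaTotal, hξ]⟩
  rw [← theta_theta_inv A v] at hv ⊢
  rw [h.projDeriv_thetaTotal] at hv
  exact (metricForm_theta A X.1 ζ _).trans (hhor _ hv)

theorem isHorizontalLift_iff_eq_theta (h0 : r 0 = 1) (h1 : r (Fin.last d) = 1)
    (h : IsQuotientManifold n r) (hY : Y.1 = theta A X.1) {ζ : Cores n r}
    (hζ : IsHorizontalLift q ξ X ζ) (ζ' : Cores n r) :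
    IsHorizontalLift q ξ Y ζ' ↔ ζ' = theta A ζ := by
  obtain rfl : Y = thetaTotal A X := Subtype.ext hY
  have hlift := h.isHorizontalLift_thetaTotal hζ A
  have hq : proj (thetaTotal A X) = q := (h.isHorizontalLift_iff.1 hlift).2.1
  exact ⟨fun hζ' => (existsUnique_horizontalLift h0 h1 h q ξ _ hq).unique hζ' hlift,
    fun hζ' => hζ' ▸ hlift⟩

theorem preMetric_horizontalLift (h0 : r 0 = 1) (h1 : r (Fin.last d) = 1)
    (h : IsQuotientManifold n r) {ξX ηX ξY ηY : Cores n r} (hξX : IsHorizontalLift q ξ X ξX)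
    (hηX : IsHorizontalLift q η X ηX) (hξY : IsHorizontalLift q ξ Y ξY)
    (hηY : IsHorizontalLift q η Y ηY) : preMetric X ξX ηX = preMetric Y ξY ηY := by
  have hXY : proj X = proj Y :=
    (h.isHorizontalLift_iff.1 hξX).2.1.trans (h.isHorizontalLift_iff.1 hξY).2.1.symm
  obtain ⟨A, hA⟩ := (proj_eq_iff_theta h0 h1).1 hXY
  rw [(isHorizontalLift_iff_eq_theta h0 h1 h hA hξX _).1 hξY,
    (isHorizontalLift_iff_eq_theta h0 h1 h hA hηX _).1 hηY, preMetric_eq_metricForm,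
    preMetric_eq_metricForm, hA, metricForm_theta]

end HorizontalLift

theorem IsQuotientManifold.quotForm_metricForm_congr (h0 : r 0 = 1) (h1 : r (Fin.last d) = 1)
    (h : IsQuotientManifold n r) {X Y : totalSpace n r} (hXY : proj X = proj Y) :
    quotForm (metricForm X.1) (projDeriv X) = quotForm (metricForm Y.1) (projDeriv Y) := by
  obtain ⟨A, hA⟩ := (proj_eq_iff_theta h0 h1).1 hXY
  obtain rfl : Y = thetaTotal A X := Subtype.ext hA
  ext v w
  exact (quotForm_map (T := theta A) (C := .id ℝ _) (FullRank.posDefForm_metricForm X.2 h0 h1)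
    (h.surjective_projDeriv X) (FullRank.posDefForm_metricForm (thetaTotal A X).2 h0 h1)
    (h.surjective_projDeriv _) (fun ζ => ⟨theta A⁻¹ ζ, theta_theta_inv A ζ⟩)
    Function.injective_id (metricForm_theta A X.1) (h.projDeriv_thetaTotal A X) v w).symm

variable [IsManifold 𝓘(ℝ, QuotientModel n r) ∞ (QuotientSpace n r)]

theorem IsQuotientManifold.exists_metric (h0 : r 0 = 1) (h1 : r (Fin.last d) = 1)
    (h : IsQuotientManifold n r) :
    ∃ g : Bundle.ContMDiffRiemannianMetric 𝓘(ℝ, QuotientModel n r) ∞ (QuotientModel n r)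
        (fun q : QuotientSpace n r => TangentSpace 𝓘(ℝ, QuotientModel n r) q),
      ∀ (q : QuotientSpace n r) (ξ η : TangentSpace 𝓘(ℝ, QuotientModel n r) q)
        (X : totalSpace n r) (ξX ηX : Cores n r),
        IsHorizontalLift q ξ X ξX → IsHorizontalLift q η X ηX →
        g.inner q ξ η = preMetric X ξX ηX := by
  have hpos (X : totalSpace n r) : PosDefForm (metricForm X.1) :=
    FullRank.posDefForm_metricForm X.2 h0 h1
  obtain ⟨g, hg⟩ := exists_riemannianMetric_eq_quotForm proj_surjective h.contMDiff_proj
    h.surjective_projDeriv hpos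
    contMDiff_metricForm (fun X Y hXY => h.quotForm_metricForm_congr h0 h1 hXY)
  refine ⟨g, fun q ξ η X ξX ηX hξ hη => ?_⟩
  obtain ⟨hhor, rfl, rfl⟩ := h.isHorizontalLift_iff.1 hξ
  obtain ⟨-, -, rfl⟩ := h.isHorizontalLift_iff.1 hη
  rw [hg]
  exact quotForm_apply (hpos X) (h.surjective_projDeriv X) hhor ηX

theorem existsUnique_metric (h0 : r 0 = 1) (h1 : r (Fin.last d) = 1)
    (h : IsQuotientManifold n r) :
    ∃! g : Bundle.ContMDiffRiemannianMetric 𝓘(ℝ, QuotientModel n r) ∞ (QuotientModel n r)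
        (fun q : QuotientSpace n r => TangentSpace 𝓘(ℝ, QuotientModel n r) q),
      ∀ (q : QuotientSpace n r) (ξ η : TangentSpace 𝓘(ℝ, QuotientModel n r) q)
        (X : totalSpace n r) (ξX ηX : Cores n r),
        IsHorizontalLift q ξ X ξX → IsHorizontalLift q η X ηX →
        g.inner q ξ η = preMetric X ξX ηX := by
  obtain ⟨g, hg⟩ := h.exists_metric h0 h1
  refine ⟨g, hg, fun g' hg' => ?_⟩
  have hinner : g'.inner = g.inner := by
    funext q
    ext ξ η
    obtain ⟨X, hX⟩ := proj_surjective q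
    obtain ⟨ξX, hξ, -⟩ := existsUnique_horizontalLift h0 h1 h q ξ X hX
    obtain ⟨ηX, hη, -⟩ := existsUnique_horizontalLift h0 h1 h q η X hX
    rw [hg' q ξ η X ξX ηX hξ hη, hg q ξ η X ξX ηX hξ hη]
  cases g
  cases g'
  congr

end Structure

end TensorTrain

end

theorem mainTheorem5 {d : ℕ} (n : Fin d → ℕ) (r : Fin (d + 1) → ℕ)
    (hr_zero : r 0 = 1) (hr_last : r (Fin.last d) = 1) :
    -- the equivalence classes are the orbits of the group
    (∀ X Y : TensorTrain.totalSpace n r, TensorTrain.proj X = TensorTrain.proj Y ↔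
      ∃ A : TensorTrain.gaugeGroup r, Y.1 = TensorTrain.theta A X.1) ∧
    -- the quotient carries the structure of a quotient manifold
    T2Space (TensorTrain.QuotientSpace n r) ∧
    SecondCountableTopology (TensorTrain.QuotientSpace n r) ∧
    (∃ _ : ChartedSpace (TensorTrain.QuotientModel n r) (TensorTrain.QuotientSpace n r),
      TensorTrain.IsQuotientManifold n r) ∧
    -- and for this structure:
    (∀ [ChartedSpace (TensorTrain.QuotientModel n r) (TensorTrain.QuotientSpace n r)]
        [IsManifold 𝓘(ℝ, TensorTrain.QuotientModel n r) ∞ (TensorTrain.QuotientSpace n r)],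
      TensorTrain.IsQuotientManifold n r →
      -- existence and uniqueness of horizontal lifts
      (∀ (q : TensorTrain.QuotientSpace n r)
          (ξ : TangentSpace 𝓘(ℝ, TensorTrain.QuotientModel n r) q)
          (X : TensorTrain.totalSpace n r), TensorTrain.proj X = q →
          ∃! ξbar, TensorTrain.IsHorizontalLift q ξ X ξbar) ∧
      -- horizontal lifts at equivalent points are related by the group action
      (∀ (q : TensorTrain.QuotientSpace n r)
          (ξ : TangentSpace 𝓘(ℝ, TensorTrain.QuotientModel n r) q)
          (X Y : TensorTrain.totalSpace n r) (A : TensorTrain.gaugeGroup r),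
          Y.1 = TensorTrain.theta A X.1 →
          ∀ ξX, TensorTrain.IsHorizontalLift q ξ X ξX →
          ∀ ξY, TensorTrain.IsHorizontalLift q ξ Y ξY ↔ ξY = TensorTrain.theta A ξX) ∧
      -- the preconditioned metric on horizontal lifts does not depend on the representative
      (∀ (q : TensorTrain.QuotientSpace n r)
          (ξ η : TangentSpace 𝓘(ℝ, TensorTrain.QuotientModel n r) q)
          (X Y : TensorTrain.totalSpace n r) (ξX ηX ξY ηY : TensorTrain.Cores n r),
          TensorTrain.IsHorizontalLift q ξ X ξX → TensorTrain.IsHorizontalLift q η X ηX →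
          TensorTrain.IsHorizontalLift q ξ Y ξY → TensorTrain.IsHorizontalLift q η Y ηY →
          TensorTrain.preMetric X ξX ηX = TensorTrain.preMetric Y ξY ηY) ∧
      -- it induces a smooth Riemannian metric on the quotient
      (∃! g : Bundle.ContMDiffRiemannianMetric 𝓘(ℝ, TensorTrain.QuotientModel n r) ∞
          (TensorTrain.QuotientModel n r)
          (fun q : TensorTrain.QuotientSpace n r =>
            TangentSpace 𝓘(ℝ, TensorTrain.QuotientModel n r) q),
        ∀ (q : TensorTrain.QuotientSpace n r)
          (ξ η : TangentSpace 𝓘(ℝ, TensorTrain.QuotientModel n r) q)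
          (X : TensorTrain.totalSpace n r) (ξX ηX : TensorTrain.Cores n r),
          TensorTrain.IsHorizontalLift q ξ X ξX → TensorTrain.IsHorizontalLift q η X ηX →
          g.inner q ξ η = TensorTrain.preMetric X ξX ηX)) := by
  refine ⟨fun X Y => TensorTrain.proj_eq_iff_theta hr_zero hr_last,
    TensorTrain.t2Space_quotientSpace n r,
    TensorTrain.secondCountable_quotientSpace hr_zero hr_last,
    TensorTrain.exists_isQuotientManifold hr_zero hr_last, ?_⟩
  intro _ _ h
  exact ⟨TensorTrain.existsUnique_horizontalLift hr_zero hr_last h,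
    fun q ξ X Y A hY ξX hξX =>
      TensorTrain.isHorizontalLift_iff_eq_theta hr_zero hr_last h hY hξX,
    fun q ξ η X Y ξX ηX ξY ηY =>
      TensorTrain.preMetric_horizontalLift hr_zero hr_last h,
    TensorTrain.existsUnique_metric hr_zero hr_last h⟩
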